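/- Let $N\ge 1$, let $\mathcal H=L^2(\mathbb R^N)$ be the Hilbert space of $N$ bosonic modes, let ${\bf\Omega}_N=\bigoplus_{j=1}^N\begin{pmatrix}0&1\\-1&0\end{pmatrix}$, and let $W({\bf x})=e^{-i{\bf x}^T{\bf\Omega}_N{\bf R}}$, ${\bf x}\in\mathbb R^{2N}$, be the Weyl operators, where ${\bf R}=(Q_1,P_1,\dots,Q_N,P_N)^T$ are the canonical quadratures; thus $(W({\bf x})\psi)(t)=e^{i(p\cdot t-p\cdot q/2)}\psi(t-q)$ for ${\bf x}=(q_1,p_1,\dots,q_N,p_N)^T$. An observable with outcome space $\mathbb R^M$ is a normalized positive operator valued measure $\mathsf E:\mathcal B(\mathbb R^M)\to\mathcal L(\mathcal H)$. It is commutative if $\mathsf E(X)\mathsf E(Y)=\mathsf E(Y)\mathsf E(X)$ for all Borel sets $X,Y$, and sharp if $\mathsf E(X)\mathsf E(Y)=\mathsf E(X\cap Y)$ for all Borel sets $X,Y$. It is Gaussian with parameters $({\bf A}_0,{\bf B}_0,{\bf v}_0)$, where ${\bf A}_0$ is a real $2N\times M$ matrix, ${\bf B}_0$ a real $M\times M$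 matrix and ${\bf v}_0\in\mathbb R^M$, if ${\bf B}_0-i{\bf A}_0^T{\bf\Omega}_N{\bf A}_0\ge 0$ and $$\int e^{i{\bf p}^T{\bf x}}\,\mathsf E(d{\bf x})=e^{-\frac14{\bf p}^T{\bf B}_0{\bf p}-i{\bf v}_0^T{\bf p}}\,W({\bf A}_0{\bf p})\quad\text{for all }{\bf p}\in\mathbb R^M.$$ For a probability measure $\mu$ on $\mathbb R^M$ the smearing $\mu*\mathsf E$ is given by $(\mu*\mathsf E)(X)=\int\mu(X-{\bf x})\,\mathsf E(d{\bf x})$; it is a Gaussian smearing if $\mu$ is Gaussian, i.e. $\int e^{i{\bf p}^T{\bf x}}\mu(d{\bf x})=e^{-\frac14{\bf p}^T{\bf C}{\bf p}-i{\bf d}^T{\bf p}}$ with some ${\bf d}\in\mathbb R^M$ and some real symmetric ${\bf C}\ge 0$. A family $(\mathsf E_j)_{j\in I}$ of observables, with outcome spaces $\mathbb R^{M_j}$, is informationally complete if any two states $\rho,\sigma$ (positive operators of trace one) with $\operatorname{tr}[\rho\mathsf E_j(X)]=\operatorname{tr}[\sigma\mathsf E_j(X)]$ for all $j\in I$ and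 all Borel sets $X$ are equal. (1) For every real $2N\times M$ matrix ${\bf A}_0$ with ${\bf A}_0^T{\bf\Omega}_N{\bf A}_0=0$ and every ${\bf v}_0\in\mathbb R^M$ there is exactly one Gaussian observable with parameters $({\bf A}_0,0,{\bf v}_0)$. For ${\bf v}_0=0$ it is denoted by $\mathsf Q_{{\bf A}_0}$. (2) Let $\mathsf E$ be a Gaussian observable with parameters $({\bf A}_0,{\bf B}_0,{\bf v}_0)$. Then the following are equivalent: (a) $\mathsf E$ is commutative; (b) ${\bf A}_0^T{\bf\Omega}_N{\bf A}_0=0$; (c) $\mathsf E$ is a Gaussian smearing of some sharp Gaussian observable; (d) there is a Gaussian observable $\mathsf Q_{{\bf A}_0}$ with parameters $({\bf A}_0,0,0)$, it is sharp, and $\mathsf E=\mu*\mathsf Q_{{\bf A}_0}$, where $\mu$ is a Gaussian probability measure with $\int e^{i{\bf p}^T{\bf x}}\mu(d{\bf x})=e^{-\frac14{\bf p}^T{\bf B}_0{\bf p}-i{\bf v}_0^T{\bf p}}$. (3) A Gaussian observable with parameters $({\bf A}_0,{\bf B}_0,{\bf v}_0)$ is sharp if and only if ${\bf B}_0=0$.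 (4) If a Gaussian observable with parameters $({\bf A}_0,{\bf B}_0,{\bf v}_0)$ is commutative, then $\operatorname{rank}{\bf A}_0\le N$. (5) No finite family of commutative Gaussian observables is informationally complete; in particular, no finite family of projection valued Gaussian observables is informationally complete. -/

import Mathlib

open MeasureTheory
open scoped Matrix ComplexOrder

namespace GaussianObs

noncomputable section

/-- Index set of the coordinates `(q₁, p₁, …, q_N, p_N)` of the phase space `ℝ^{2N}`:
`(0, j)` is the index of `q_j` and `(1, j)` is the index of `p_j`. -/
abbrev PhaseIdx (N : ℕ) : Type := Fin 2 × Fin N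

/-- The phase space `ℝ^{2N}` of `N` modes. -/
abbrev PhaseSpace (N : ℕ) : Type := PhaseIdx N → ℝ

/-- `Ω_N`, the direct sum of `N` copies of `ω = (0 1; -1 0)`. -/
def Omega (N : ℕ) : Matrix (PhaseIdx N) (PhaseIdx N) ℝ :=
  Matrix.blockDiagonal fun _ : Fin N => !![0, 1; -1, 0]

/-- The Hilbert space of `N` modes in the coordinate representation, `L²(ℝ^N)`. -/
abbrev Hilb (N : ℕ) : Type := Lp ℂ 2 (volume : Measure (Fin N → ℝ))

/-- The phase `exp(i (p·t - p·q/2))` in the Weyl operator of `x = (q, p)`. -/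
def weylPhase {N : ℕ} (x : PhaseSpace N) (t : Fin N → ℝ) : ℂ :=
  Complex.exp
    (((∑ j, x (1, j) * t j - (∑ j, x (1, j) * x (0, j)) / 2 : ℝ) : ℂ) * Complex.I)

/-- The function `t ↦ exp(i (p·t - p·q/2)) ψ(t - q)`. -/
def weylFun {N : ℕ} (x : PhaseSpace N) (ψ : (Fin N → ℝ) → ℂ) (t : Fin N → ℝ) : ℂ :=
  weylPhase x t * ψ (t - fun j => x (0, j))

theorem norm_weylPhase {N : ℕ} (x : PhaseSpace N) (t : Fin N → ℝ) : ‖weylPhase x t‖ = 1 :=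
  Complex.norm_exp_ofReal_mul_I _

theorem continuous_weylPhase {N : ℕ} (x : PhaseSpace N) : Continuous (weylPhase x) := by
  unfold weylPhase
  fun_prop

theorem norm_weylFun {N : ℕ} (x : PhaseSpace N) (ψ : (Fin N → ℝ) → ℂ) (t : Fin N → ℝ) :
    ‖weylFun x ψ t‖ = ‖ψ (t - fun j => x (0, j))‖ := by
  rw [weylFun, norm_mul, norm_weylPhase, one_mul]

theorem weylFun_congr {N : ℕ} (x : PhaseSpace N) {ψ φ : (Fin N → ℝ) → ℂ}
    (h : ψ =ᵐ[volume] φ) : weylFun x ψ =ᵐ[volume] weylFun x φ := by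
  have h' := (measurePreserving_sub_right (volume : Measure (Fin N → ℝ))
    (fun j => x (0, j))).quasiMeasurePreserving.ae_eq_comp h
  filter_upwards [h'] with t ht
  simp only [Function.comp_apply] at ht
  simp only [weylFun, ht]

theorem memLp_weylFun {N : ℕ} (x : PhaseSpace N) (ψ : Hilb N) :
    MemLp (weylFun x ψ) 2 volume := by
  have h : MemLp (fun t => ψ (t - fun j => x (0, j))) 2 volume :=
    (Lp.memLp ψ).comp_measurePreserving (measurePreserving_sub_right volume _)
  refine h.congr_norm ?_ (Filter.Eventually.of_forall fun t => (norm_weylFun x ψ t).symm)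
  exact (continuous_weylPhase x).aestronglyMeasurable.mul h.1

theorem eLpNorm_weylFun {N : ℕ} (x : PhaseSpace N) (ψ : Hilb N) :
    eLpNorm (weylFun x ψ) 2 volume = eLpNorm ψ 2 volume := by
  have h : eLpNorm (fun t => ψ (t - fun j => x (0, j))) 2 volume = eLpNorm ψ 2 volume :=
    eLpNorm_comp_measurePreserving (Lp.memLp ψ).1 (measurePreserving_sub_right volume _)
  rw [← h]
  exact eLpNorm_congr_norm_ae (Filter.Eventually.of_forall fun t => norm_weylFun x ψ t)

/-- The Weyl operator `W(x) = exp(-i xᵀ Ω R) = exp(i ∑ⱼ (pⱼ Qⱼ - qⱼ Pⱼ))` for `x = (q, p)`. On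
`L²(ℝ^N)`, with `Qⱼ` the multiplication by `tⱼ` and `Pⱼ = -i ∂ⱼ`, it acts by
`(W(q, p) ψ)(t) = exp(i (p·t - p·q/2)) ψ(t - q)`. -/
def weyl {N : ℕ} (x : PhaseSpace N) : Hilb N →L[ℂ] Hilb N :=
  LinearIsometry.toContinuousLinearMap
    { toFun := fun ψ => (memLp_weylFun x ψ).toLp _
      map_add' := fun ψ φ => by
        rw [← MemLp.toLp_add, MemLp.toLp_eq_toLp_iff]
        refine (weylFun_congr x (Lp.coeFn_add ψ φ)).trans
          (Filter.Eventually.of_forall fun t => ?_)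
        simp only [weylFun, Pi.add_apply, mul_add]
      map_smul' := fun c ψ => by
        rw [RingHom.id_apply, ← MemLp.toLp_const_smul, MemLp.toLp_eq_toLp_iff]
        refine (weylFun_congr x (Lp.coeFn_smul c ψ)).trans
          (Filter.Eventually.of_forall fun t => ?_)
        simp only [weylFun, Pi.smul_apply, smul_eq_mul]
        ring
      norm_map' := fun ψ => by
        change ‖(memLp_weylFun x ψ).toLp _‖ = ‖ψ‖
        rw [Lp.norm_toLp, eLpNorm_weylFun, Lp.norm_def] }

/-! ### Observables -/

/-- An observable with outcome space `ℝ^M`: a normalized positive operator valued measure on the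
Borel sets of `ℝ^M`, with σ-additivity in the weak operator topology. Sets that are not Borel
get the value `0`, so that two observables are equal as soon as they agree on the Borel sets. -/
structure Observable (N M : ℕ) where
  op : Set (Fin M → ℝ) → (Hilb N →L[ℂ] Hilb N)
  op_not_measurable : ∀ X, ¬ MeasurableSet X → op X = 0
  op_positive : ∀ X, MeasurableSet X → (op X).IsPositive
  op_univ : op Set.univ = 1
  op_iUnion : ∀ X : ℕ → Set (Fin M → ℝ), (∀ k, MeasurableSet (X k)) →
    Pairwise (Function.onFun Disjoint X) →
    ∀ φ ψ : Hilb N, HasSum (fun k => inner ℂ φ (op (X k) ψ)) (inner ℂ φ (op (⋃ k, X k) ψ))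

namespace Observable

variable {N M : ℕ}

theorem re_inner_empty (E : Observable N M) (φ : Hilb N) :
    (inner ℂ φ (E.op ∅ φ)).re = 0 := by
  have h := E.op_iUnion (fun _ => ∅) (fun _ => MeasurableSet.empty)
    (fun _ _ _ => disjoint_bot_left) φ φ
  have h0 := tendsto_nhds_unique tendsto_const_nhds h.summable.tendsto_atTop_zero
  rw [h0, Complex.zero_re]

/-- The finite measure `X ↦ ⟨φ, E(X) φ⟩`. -/
def diagMeasure (E : Observable N M) (φ : Hilb N) : Measure (Fin M → ℝ) :=
  Measure.ofMeasurable (fun X _ => ENNReal.ofReal (inner ℂ φ (E.op X φ)).re)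
    (by rw [E.re_inner_empty φ, ENNReal.ofReal_zero])
    (fun X hX hd => by
      have h : HasSum (fun k => (inner ℂ φ (E.op (X k) φ)).re)
          (inner ℂ φ (E.op (⋃ k, X k) φ)).re := Complex.hasSum_re (E.op_iUnion X hX hd φ φ)
      rw [← h.tsum_eq]
      exact ENNReal.ofReal_tsum_of_nonneg
        (fun k => (E.op_positive (X k) (hX k)).re_inner_nonneg_right φ) h.summable)

/-- `E.HasIntegral f T` says that `T = ∫ f(x) E(dx)` in the weak sense,
`⟨φ, T φ⟩ = ∫ f(x) ⟨φ, E(dx) φ⟩` for all `φ`; by polarization this determines `T`. -/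
def HasIntegral (E : Observable N M) (f : (Fin M → ℝ) → ℂ) (T : Hilb N →L[ℂ] Hilb N) : Prop :=
  ∀ φ : Hilb N, Integrable f (E.diagMeasure φ) ∧
    inner ℂ φ (T φ) = ∫ x, f x ∂(E.diagMeasure φ)

end Observable

/-- The character `x ↦ exp(i pᵀx)` of `ℝ^M`. -/
def character {M : ℕ} (p x : Fin M → ℝ) : ℂ :=
  Complex.exp (((p ⬝ᵥ x : ℝ) : ℂ) * Complex.I)

/-- The function `p ↦ exp(-(1/4) pᵀ B p - i vᵀ p)`. -/
def gaussianFactor {M : ℕ} (B : Matrix (Fin M) (Fin M) ℝ) (v p : Fin M → ℝ) : ℂ :=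
  Complex.exp (-(1 / 4 : ℂ) * ((p ⬝ᵥ (B *ᵥ p) : ℝ) : ℂ) - Complex.I * ((v ⬝ᵥ p : ℝ) : ℂ))

/-- `μ` is the Gaussian probability measure on `ℝ^M` with
`∫ exp(i pᵀx) μ(dx) = exp(-(1/4) pᵀ C p - i dᵀ p)`, where `C ≥ 0`. -/
def IsGaussianMeasureWith {M : ℕ} (μ : Measure (Fin M → ℝ)) (C : Matrix (Fin M) (Fin M) ℝ)
    (d : Fin M → ℝ) : Prop :=
  IsProbabilityMeasure μ ∧ C.PosSemidef ∧
    ∀ p : Fin M → ℝ, ∫ x, character p x ∂μ = gaussianFactor C d p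

namespace Observable

variable {N M : ℕ}

/-- `E` is the Gaussian observable with parameters `(A, B, v)`: its characteristic function is
`∫ exp(i pᵀx) E(dx) = exp(-(1/4) pᵀ B p - i vᵀ p) W(A p)`, and `B - i Aᵀ Ω A ≥ 0`. -/
def IsGaussianWith (E : Observable N M) (A : Matrix (PhaseIdx N) (Fin M) ℝ)
    (B : Matrix (Fin M) (Fin M) ℝ) (v : Fin M → ℝ) : Prop :=
  (B.map Complex.ofReal - Complex.I • (Aᵀ * Omega N * A).map Complex.ofReal).PosSemidef ∧
    ∀ p : Fin M → ℝ, E.HasIntegral (character p) (gaussianFactor B v p • weyl (A *ᵥ p))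

/-- `E` is a Gaussian observable. -/
def IsGaussian (E : Observable N M) : Prop :=
  ∃ A B v, E.IsGaussianWith A B v

/-- `E(X) E(Y) = E(Y) E(X)` for all Borel sets `X`, `Y`. -/
def IsCommutative (E : Observable N M) : Prop :=
  ∀ X Y, MeasurableSet X → MeasurableSet Y → E.op X * E.op Y = E.op Y * E.op X

/-- `E(X) E(Y) = E(X ∩ Y)` for all Borel sets `X`, `Y`. -/
def IsSharp (E : Observable N M) : Prop :=
  ∀ X Y, MeasurableSet X → MeasurableSet Y → E.op X * E.op Y = E.op (X ∩ Y)

/-- Every `E(X)` is an orthogonal projection. -/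
def IsProjectionValued (E : Observable N M) : Prop :=
  ∀ X, MeasurableSet X → IsStarProjection (E.op X)

/-- `E` is the smearing `μ * F` of the observable `F`, that is, `E(X) = ∫ μ(X - x) F(dx)` for all
Borel sets `X`, where `X - x = {y | y + x ∈ X}`. -/
def IsSmearing (E : Observable N M) (μ : Measure (Fin M → ℝ)) (F : Observable N M) : Prop :=
  ∀ X, MeasurableSet X → F.HasIntegral (fun x => ((μ.real {y | y + x ∈ X} : ℝ) : ℂ)) (E.op X)

/-- `E = μ * Q` for a Gaussian probability measure `μ` and a sharp Gaussian observable `Q`. -/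
def IsGaussianSmearingOfSharp (E : Observable N M) : Prop :=
  ∃ (μ : Measure (Fin M → ℝ)) (Q : Observable N M),
    (∃ C d, IsGaussianMeasureWith μ C d) ∧ Q.IsGaussian ∧ Q.IsSharp ∧ E.IsSmearing μ Q

end Observable

/-! ### States and informational completeness -/

/-- Index set of a fixed orthonormal Hilbert basis of `L²(ℝ^N)`. -/
def basisIdx (N : ℕ) : Set (Hilb N) := Classical.choose (exists_hilbertBasis ℂ (Hilb N))

/-- A fixed orthonormal Hilbert basis of `L²(ℝ^N)`. -/
def basis (N : ℕ) : HilbertBasis (basisIdx N) ℂ (Hilb N) :=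
  Classical.choose (Classical.choose_spec (exists_hilbertBasis ℂ (Hilb N)))

/-- The trace `∑ᵢ ⟨eᵢ, T eᵢ⟩`. It is used for trace class operators only, and for them it does
not depend on the orthonormal basis. -/
def trace {N : ℕ} (T : Hilb N →L[ℂ] Hilb N) : ℂ :=
  ∑' i, inner ℂ (basis N i) (T (basis N i))

/-- A state: a positive operator of trace one. -/
def IsState {N : ℕ} (ρ : Hilb N →L[ℂ] Hilb N) : Prop :=
  ρ.IsPositive ∧ HasSum (fun i => inner ℂ (basis N i) (ρ (basis N i))) 1

/-- A family of observables is informationally complete if every state is determined by its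
outcome distributions `X ↦ tr(ρ E_j(X))`. -/
def InformationallyComplete {N : ℕ} {ι : Type*} {M : ι → ℕ}
    (E : ∀ j, Observable N (M j)) : Prop :=
  ∀ ρ σ : Hilb N →L[ℂ] Hilb N, IsState ρ → IsState σ →
    (∀ j X, MeasurableSet X → trace (ρ * (E j).op X) = trace (σ * (E j).op X)) → ρ = σ

end

end GaussianObs

/-! Operators are compared through complex measures and their Fourier transforms. For vectors `a`,
`b` the functional taking `g` to the integral of `g` against `⟨a, E(dx) b⟩` comes from a complex
measure, so it is determined by its values on indicators, and equally by its values on characters.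
Relations between the effects `E(X)` therefore pass to the operators `S p = gaussianFactor B v p •
weyl (A *ᵥ p)`, and back.

If `E` is commutative, the `S p` commute. The Weyl relation makes `W(Ap) W(Aq)` and `W(Aq) W(Ap)`
differ by the phase `exp(-i symp (Ap) (Aq))`, so the symplectic form vanishes on the range of `A`;
the rank bound is the dimension bound for isotropic subspaces. Conversely, isotropy turns `p ↦
exp(-i vᵀp) W(Ap)` into a strongly continuous unitary representation of `ℝ^M`. Bochner's theorem
attaches a measure to each vector, and polarization assembles these measures into an observable
(`exists_of_measures`), which is sharp because `S p * S q = S (p + q)`. The remaining factor of a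
Gaussian observable with isotropic `A` is the Fourier transform of a classical Gaussian measure.
Products of characteristic functions are convolutions, so `E` is a smearing; smearings of a sharp
observable commute. Sharpness in general gives `S (-p) * S p = 1`, whereas the Weyl relation gives
`exp(-pᵀBp/2)`, hence `B = 0`.

For incompleteness, each commutative Gaussian `E j` commutes with `W(w j)` for some nonzero `w j`
symplectically orthogonal to the range of its matrix. Shift one vector by all subset sums of the `w
j`, and mix the even subsets into one state, the odd ones into another. Toggling `j` pairs even with
odd subsets without changing the statistics of `E j`. A generic Weyl operator separates the two
states, because the alternating sum of its expectations factors into a nonzero product. -/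

namespace GaussianObs

noncomputable section

/-! ### Functionals given by complex measures -/

/-- `g` is a bounded measurable function. -/
def IsBddMeas {α : Type*} [MeasurableSpace α] (g : α → ℂ) : Prop :=
  Measurable g ∧ ∃ C : ℝ, ∀ x, ‖g x‖ ≤ C

section BddMeas

variable {α : Type*} [MeasurableSpace α] {g h : α → ℂ}

theorem IsBddMeas.integrable (hg : IsBddMeas g) (μ : Measure α) [IsFiniteMeasure μ] :
    Integrable g μ := by
  obtain ⟨hm, C, hC⟩ := hg
  exact Integrable.of_bound hm.aestronglyMeasurable C (Filter.Eventually.of_forall hC)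

theorem IsBddMeas.mul (hg : IsBddMeas g) (hh : IsBddMeas h) : IsBddMeas fun x => g x * h x := by
  obtain ⟨hm, C, hC⟩ := hg
  obtain ⟨hm', D, hD⟩ := hh
  refine ⟨hm.mul hm', C * D, fun x => ?_⟩
  rw [norm_mul]
  exact mul_le_mul (hC x) (hD x) (norm_nonneg _) ((norm_nonneg _).trans (hC x))

theorem isBddMeas_const (c : ℂ) : IsBddMeas fun _ : α => c :=
  ⟨measurable_const, ‖c‖, fun _ => le_rfl⟩

theorem isBddMeas_indicator {X : Set α} (hX : MeasurableSet X) :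
    IsBddMeas (X.indicator fun _ => (1 : ℂ)) := by
  refine ⟨measurable_const.indicator hX, 1, fun x => ?_⟩
  exact (norm_indicator_le_norm_self _ _).trans (by simp)

theorem IsBddMeas.ofReal {u : α → ℝ} (hu : Measurable u) {C : ℝ} (hC : ∀ x, |u x| ≤ C) :
    IsBddMeas fun x => (u x : ℂ) :=
  ⟨Complex.measurable_ofReal.comp hu, C, fun x => by simpa using hC x⟩

theorem integral_indicator_one_complex (μ : Measure α) {X : Set α} (hX : MeasurableSet X) :
    ∫ x, X.indicator (fun _ => (1 : ℂ)) x ∂μ = (μ.real X : ℂ) := by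
  rw [integral_indicator hX, setIntegral_const]
  simp

/-- The functional `g ↦ ∫ g dμ` of a finite signed measure `μ`, on bounded measurable functions. -/
def IsSignedFunctional (L : (α → ℂ) → ℂ) : Prop :=
  ∃ μ ν : Measure α, IsFiniteMeasure μ ∧ IsFiniteMeasure ν ∧
    ∀ g, IsBddMeas g → L g = ∫ x, g x ∂μ - ∫ x, g x ∂ν

/-- The functional `g ↦ ∫ g dμ` of a complex measure `μ`, on bounded measurable functions. -/
def IsComplexFunctional (L : (α → ℂ) → ℂ) : Prop :=
  ∃ L₁ L₂ : (α → ℂ) → ℂ, IsSignedFunctional L₁ ∧ IsSignedFunctional L₂ ∧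
    ∀ g, IsBddMeas g → L g = L₁ g + Complex.I * L₂ g

theorem isSignedFunctional_integral (μ : Measure α) [IsFiniteMeasure μ] :
    IsSignedFunctional fun g => ∫ x, g x ∂μ :=
  ⟨μ, 0, inferInstance, inferInstance, fun g _ => by simp⟩

theorem IsSignedFunctional.neg {L : (α → ℂ) → ℂ} (hL : IsSignedFunctional L) :
    IsSignedFunctional fun g => -L g := by
  obtain ⟨μ, ν, hμ, hν, h⟩ := hL
  exact ⟨ν, μ, hν, hμ, fun g hg => by simp only [h g hg, neg_sub]⟩

theorem IsSignedFunctional.add {L L' : (α → ℂ) → ℂ} (hL : IsSignedFunctional L)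
    (hL' : IsSignedFunctional L') : IsSignedFunctional fun g => L g + L' g := by
  obtain ⟨μ, ν, hμ, hν, h⟩ := hL
  obtain ⟨μ', ν', hμ', hν', h'⟩ := hL'
  refine ⟨μ + μ', ν + ν', inferInstance, inferInstance, fun g hg => ?_⟩
  beta_reduce
  rw [h g hg, h' g hg, integral_add_measure (hg.integrable _) (hg.integrable _),
    integral_add_measure (hg.integrable _) (hg.integrable _)]
  ring

theorem integral_withDensity_ofReal {u : α → ℝ} (hu : Measurable u) (h0 : ∀ x, 0 ≤ u x)
    (μ : Measure α) (g : α → ℂ) :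
    ∫ x, g x ∂(μ.withDensity fun x => ENNReal.ofReal (u x)) = ∫ x, (u x : ℂ) * g x ∂μ := by
  rw [integral_withDensity_eq_integral_toReal_smul hu.ennreal_ofReal (by simp)]
  refine integral_congr_ae (Filter.Eventually.of_forall fun x => ?_)
  simp [ENNReal.toReal_ofReal (h0 x)]

theorem IsSignedFunctional.mul_nonneg {L : (α → ℂ) → ℂ} (hL : IsSignedFunctional L)
    {u : α → ℝ} (hu : Measurable u) (h0 : ∀ x, 0 ≤ u x) {C : ℝ} (hC : ∀ x, u x ≤ C) :
    IsSignedFunctional fun g => L fun x => (u x : ℂ) * g x := by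
  obtain ⟨μ, ν, hμ, hν, h⟩ := hL
  have hub : IsBddMeas fun x => (u x : ℂ) :=
    IsBddMeas.ofReal hu fun x => by rw [abs_of_nonneg (h0 x)]; exact hC x
  have hfin (κ : Measure α) [IsFiniteMeasure κ] :
      IsFiniteMeasure (κ.withDensity fun x => ENNReal.ofReal (u x)) := by
    refine isFiniteMeasure_withDensity_ofReal ?_
    exact (Integrable.of_bound hu.aestronglyMeasurable C (Filter.Eventually.of_forall fun x => by
      rw [Real.norm_eq_abs, abs_of_nonneg (h0 x)]; exact hC x)).2
  refine ⟨μ.withDensity fun x => ENNReal.ofReal (u x), ν.withDensity fun x => ENNReal.ofReal (u x),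
    hfin μ, hfin ν, fun g hg => ?_⟩
  beta_reduce
  rw [h _ (hub.mul hg), integral_withDensity_ofReal hu h0, integral_withDensity_ofReal hu h0]

theorem IsSignedFunctional.map_add {L : (α → ℂ) → ℂ} (hL : IsSignedFunctional L)
    (hg : IsBddMeas g) (hh : IsBddMeas h) : L (fun x => g x + h x) = L g + L h := by
  obtain ⟨μ, ν, hμ, hν, hr⟩ := hL
  have : IsBddMeas fun x => g x + h x := by
    obtain ⟨hm, C, hC⟩ := hg
    obtain ⟨hm', D, hD⟩ := hh
    exact ⟨hm.add hm', C + D, fun x => (norm_add_le _ _).trans (add_le_add (hC x) (hD x))⟩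
  rw [hr _ this, hr g hg, hr h hh, integral_add (hg.integrable _) (hh.integrable _),
    integral_add (hg.integrable _) (hh.integrable _)]
  ring

theorem IsSignedFunctional.map_const_mul {L : (α → ℂ) → ℂ} (hL : IsSignedFunctional L)
    (c : ℂ) (hg : IsBddMeas g) : L (fun x => c * g x) = c * L g := by
  obtain ⟨μ, ν, hμ, hν, hr⟩ := hL
  rw [hr _ ((isBddMeas_const c).mul hg), hr g hg, integral_const_mul, integral_const_mul, mul_sub]

/-- Positive and negative parts of the density reduce this to nonnegative densities, which
`withDensity` absorbs into the two measures; the minus sign exchanges those measures. -/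
theorem IsSignedFunctional.mul_real {L : (α → ℂ) → ℂ} (hL : IsSignedFunctional L)
    {u : α → ℝ} (hu : Measurable u) {C : ℝ} (hC : ∀ x, |u x| ≤ C) :
    IsSignedFunctional fun g => L fun x => (u x : ℂ) * g x := by
  have h1 := hL.mul_nonneg (u := fun x => max (u x) 0) (hu.max measurable_const)
    (fun x => le_max_right _ _) (C := C)
    (fun x => max_le ((le_abs_self _).trans (hC x)) ((abs_nonneg _).trans (hC x)))
  have h2 := hL.mul_nonneg (u := fun x => max (-u x) 0) (hu.neg.max measurable_const)
    (fun x => le_max_right _ _) (C := C)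
    (fun x => max_le ((neg_le_abs _).trans (hC x)) ((abs_nonneg _).trans (hC x)))
  obtain ⟨μ, ν, hμ, hν, h⟩ := h1.add h2.neg
  refine ⟨μ, ν, hμ, hν, fun g hg => ?_⟩
  rw [← h g hg]
  beta_reduce
  have hb1 : IsBddMeas fun x => ((max (u x) 0 : ℝ) : ℂ) :=
    IsBddMeas.ofReal (hu.max measurable_const) (C := C) fun x => by
      rw [abs_of_nonneg (le_max_right _ _)]
      exact max_le ((le_abs_self _).trans (hC x)) ((abs_nonneg _).trans (hC x))
  have hb2 : IsBddMeas fun x => ((max (-u x) 0 : ℝ) : ℂ) :=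
    IsBddMeas.ofReal (hu.neg.max measurable_const) (C := C) fun x => by
      rw [abs_of_nonneg (le_max_right _ _)]
      exact max_le ((neg_le_abs _).trans (hC x)) ((abs_nonneg _).trans (hC x))
  have hsum := hL.map_add (hb1.mul hg) ((isBddMeas_const (-1)).mul (hb2.mul hg))
  rw [hL.map_const_mul _ (hb2.mul hg), neg_one_mul] at hsum
  rw [← hsum]
  congr 1
  funext x
  have : u x = max (u x) 0 - max (-u x) 0 := by
    rcases le_total 0 (u x) with h | h
    · simp [h]
    · simp [h]
  conv_lhs => rw [this]
  push_cast
  ring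

theorem IsSignedFunctional.isComplexFunctional {L : (α → ℂ) → ℂ} (hL : IsSignedFunctional L) :
    IsComplexFunctional L :=
  ⟨L, fun _ => 0, hL, ⟨0, 0, inferInstance, inferInstance, by simp⟩, by simp⟩

theorem isComplexFunctional_integral (μ : Measure α) [IsFiniteMeasure μ] :
    IsComplexFunctional fun g => ∫ x, g x ∂μ :=
  (isSignedFunctional_integral μ).isComplexFunctional

theorem IsComplexFunctional.add {L L' : (α → ℂ) → ℂ} (hL : IsComplexFunctional L)
    (hL' : IsComplexFunctional L') : IsComplexFunctional fun g => L g + L' g := by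
  obtain ⟨L₁, L₂, h₁, h₂, h⟩ := hL
  obtain ⟨L₁', L₂', h₁', h₂', h'⟩ := hL'
  exact ⟨_, _, h₁.add h₁', h₂.add h₂', fun g hg => by simp only [h g hg, h' g hg]; ring⟩

/-- This closure property allows measures such as `exp(i pᵀx) ⟨φ, E(dx) φ⟩` to enter the same
uniqueness arguments as the matrix elements of `E`. -/
theorem IsComplexFunctional.mul {L : (α → ℂ) → ℂ} (hL : IsComplexFunctional L)
    (hh : IsBddMeas h) : IsComplexFunctional fun g => L fun x => h x * g x := by
  obtain ⟨L₁, L₂, h₁, h₂, hr⟩ := hL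
  obtain ⟨hm, C, hC⟩ := id hh
  have hmr : Measurable fun x => (h x).re := Complex.measurable_re.comp hm
  have hmi : Measurable fun x => (h x).im := Complex.measurable_im.comp hm
  have hCr : ∀ x, |(h x).re| ≤ C := fun x => (Complex.abs_re_le_norm _).trans (hC x)
  have hCi : ∀ x, |(h x).im| ≤ C := fun x => (Complex.abs_im_le_norm _).trans (hC x)
  refine ⟨_, _, (h₁.mul_real hmr hCr).add (h₂.mul_real hmi hCi).neg,
    (h₂.mul_real hmr hCr).add (h₁.mul_real hmi hCi), fun g hg => ?_⟩
  have key (K : (α → ℂ) → ℂ) (hK : IsSignedFunctional K) : K (fun x => h x * g x) =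
      K (fun x => ((h x).re : ℂ) * g x) + Complex.I * K (fun x => ((h x).im : ℂ) * g x) := by
    have hbr := (IsBddMeas.ofReal hmr hCr).mul hg
    have hbi := (IsBddMeas.ofReal hmi hCi).mul hg
    rw [← hK.map_const_mul _ hbi, ← hK.map_add hbr ((isBddMeas_const _).mul hbi)]
    congr 1
    funext x
    conv_lhs => rw [← Complex.re_add_im (h x)]
    ring
  beta_reduce
  rw [hr _ (hh.mul hg), key L₁ h₁, key L₂ h₂]
  linear_combination L₂ (fun x => ((h x).im : ℂ) * g x) * Complex.I_mul_I

theorem IsComplexFunctional.const_mul {L : (α → ℂ) → ℂ} (hL : IsComplexFunctional L) (c : ℂ) :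
    IsComplexFunctional fun g => c * L g := by
  obtain ⟨L₁, L₂, h₁, h₂, hr⟩ := hL.mul (isBddMeas_const c)
  refine ⟨L₁, L₂, h₁, h₂, fun g hg => ?_⟩
  rw [← hr g hg]
  beta_reduce
  obtain ⟨K₁, K₂, k₁, k₂, kr⟩ := hL
  rw [kr g hg, kr _ ((isBddMeas_const c).mul hg), k₁.map_const_mul c hg, k₂.map_const_mul c hg]
  ring

theorem IsComplexFunctional.sub {L L' : (α → ℂ) → ℂ} (hL : IsComplexFunctional L)
    (hL' : IsComplexFunctional L') : IsComplexFunctional fun g => L g - L' g := by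
  simpa [sub_eq_add_neg] using hL.add (hL'.const_mul (-1))

/-- On indicators the two signed functionals take real values, so they vanish separately; in each of
them the two measures then agree on every measurable set. -/
theorem IsComplexFunctional.eq_zero_of_indicator {L : (α → ℂ) → ℂ} (hL : IsComplexFunctional L)
    (h0 : ∀ X, MeasurableSet X → L (X.indicator fun _ => 1) = 0) (hg : IsBddMeas g) :
    L g = 0 := by
  obtain ⟨L₁, L₂, ⟨μ₁, ν₁, hμ₁, hν₁, h₁⟩, ⟨μ₂, ν₂, hμ₂, hν₂, h₂⟩, hr⟩ := hL
  have key : ∀ X, MeasurableSet X → μ₁.real X = ν₁.real X ∧ μ₂.real X = ν₂.real X := by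
    intro X hX
    have hb := isBddMeas_indicator hX
    have h := h0 X hX
    rw [hr _ hb, h₁ _ hb, h₂ _ hb] at h
    simp only [integral_indicator_one_complex _ hX] at h
    have hre := congrArg Complex.re h
    have him := congrArg Complex.im h
    simp at hre him
    exact ⟨by linarith, by linarith⟩
  have e₁ : μ₁ = ν₁ := Measure.ext fun X hX =>
    (measureReal_eq_measureReal_iff (by finiteness) (by finiteness)).1 (key X hX).1
  have e₂ : μ₂ = ν₂ := Measure.ext fun X hX =>
    (measureReal_eq_measureReal_iff (by finiteness) (by finiteness)).1 (key X hX).2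
  rw [hr g hg, h₁ g hg, h₂ g hg, e₁, e₂]
  simp

end BddMeas

/-! ### Characters -/

section Character

variable {M : ℕ}

theorem norm_character (p x : Fin M → ℝ) : ‖character p x‖ = 1 :=
  Complex.norm_exp_ofReal_mul_I _

theorem continuous_character (p : Fin M → ℝ) : Continuous (character p) := by
  unfold character dotProduct
  fun_prop

theorem isBddMeas_character (p : Fin M → ℝ) : IsBddMeas (character p) :=
  ⟨(continuous_character p).measurable, 1, fun x => (norm_character p x).le⟩

theorem character_neg (p x : Fin M → ℝ) :
    character (-p) x = (starRingEnd ℂ) (character p x) := by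
  rw [character, character, ← Complex.exp_conj, map_mul, Complex.conj_ofReal, Complex.conj_I,
    neg_dotProduct]
  push_cast
  ring_nf

theorem character_add (p q x : Fin M → ℝ) :
    character (p + q) x = character p x * character q x := by
  rw [character, character, character, ← Complex.exp_add, add_dotProduct]
  push_cast
  ring_nf

theorem character_zero (x : Fin M → ℝ) : character 0 x = 1 := by
  rw [character, zero_dotProduct, Complex.ofReal_zero, zero_mul, Complex.exp_zero]

/-- Every continuous linear functional on `ℝ^M` is a dot product, so the characters account for the
whole dual characteristic function. -/
theorem measure_ext_of_character {μ ν : Measure (Fin M → ℝ)} [IsFiniteMeasure μ]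
    [IsFiniteMeasure ν] (h : ∀ p, ∫ x, character p x ∂μ = ∫ x, character p x ∂ν) : μ = ν := by
  refine Measure.ext_of_charFunDual (funext fun L => ?_)
  have hL : ∀ x, L x = (fun i => L (Pi.single i 1)) ⬝ᵥ x := by
    intro x
    conv_lhs => rw [pi_eq_sum_univ' x]
    rw [map_sum, dotProduct]
    exact Finset.sum_congr rfl fun i _ => by
      rw [map_smul, smul_eq_mul, mul_comm]
  have hc : ∀ x, Complex.exp (L x * Complex.I) = character (fun i => L (Pi.single i 1)) x :=
    fun x => by rw [character, ← hL]
  simp only [charFunDual_apply, hc]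
  exact h _

/-- On characters `L₁` and `L₂` are complex valued, so real parts cannot separate them. Conjugating
the equation at `-p` gives `L₁ - i L₂ = 0` at `p`, which together with `L₁ + i L₂ = 0` kills both.
-/
theorem IsComplexFunctional.eq_zero_of_character {L : ((Fin M → ℝ) → ℂ) → ℂ}
    (hL : IsComplexFunctional L) (h0 : ∀ p, L (character p) = 0) {g : (Fin M → ℝ) → ℂ}
    (hg : IsBddMeas g) : L g = 0 := by
  obtain ⟨L₁, L₂, h₁, h₂, hr⟩ := hL
  have hconj (K : ((Fin M → ℝ) → ℂ) → ℂ) (hK : IsSignedFunctional K) (p) :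
      (starRingEnd ℂ) (K (character (-p))) = K (character p) := by
    obtain ⟨μ, ν, hμ, hν, h⟩ := hK
    rw [h _ (isBddMeas_character _), h _ (isBddMeas_character _), map_sub, ← integral_conj,
      ← integral_conj]
    simp only [character_neg, Complex.conj_conj]
  have hz : ∀ p, L₁ (character p) = 0 ∧ L₂ (character p) = 0 := by
    intro p
    have a := h0 p
    have b := h0 (-p)
    rw [hr _ (isBddMeas_character _)] at a b
    have b' := congrArg (starRingEnd ℂ) b
    rw [map_add, map_mul, hconj L₁ h₁, hconj L₂ h₂, Complex.conj_I, map_zero] at b'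
    constructor
    · linear_combination (a + b') / 2
    · linear_combination (-Complex.I / 2) * (a - b') + L₂ (character p) * Complex.I_mul_I
  have key (K : ((Fin M → ℝ) → ℂ) → ℂ) (hK : IsSignedFunctional K)
      (hK0 : ∀ p, K (character p) = 0) : K g = 0 := by
    obtain ⟨μ, ν, hμ, hν, h⟩ := hK
    have : μ = ν := measure_ext_of_character fun p => by
      have := hK0 p
      rwa [h _ (isBddMeas_character p), sub_eq_zero] at this
    rw [h g hg, this, sub_self]
  rw [hr g hg, key L₁ h₁ fun p => (hz p).1, key L₂ h₂ fun p => (hz p).2]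
  simp

end Character

/-! ### Polarization -/

section Polar

variable {H : Type*} [NormedAddCommGroup H] [InnerProductSpace ℂ H]

/-- Polarization of `q : H → ℂ`: if `q φ = ⟨φ, T φ⟩`, it is `⟨a, T b⟩`. -/
def polar (q : H → ℂ) (a b : H) : ℂ :=
  ∑ k : Fin 4, Complex.I ^ (k : ℕ) / 4 * q (b + Complex.I ^ (k : ℕ) • a)

theorem polar_inner (T : H →L[ℂ] H) (a b : H) :
    polar (fun φ => inner ℂ φ (T φ)) a b = inner ℂ a (T b) := by
  have h3 : Complex.I ^ 3 = -Complex.I := by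
    rw [pow_succ, Complex.I_sq]; ring
  simp only [polar, Fin.sum_univ_four, Fin.val_zero, Fin.val_one, Fin.val_two, pow_zero, pow_one,
    Complex.I_sq, show ((3 : Fin 4) : ℕ) = 3 from rfl, h3, map_add, map_smul, inner_add_left,
    inner_add_right, inner_smul_left, inner_smul_right, map_neg, map_one, Complex.conj_I]
  linear_combination ((1 : ℂ) / 2) * (inner ℂ b (T a) - inner ℂ a (T b)) * Complex.I_mul_I

theorem eq_of_inner_map {S T : H →L[ℂ] H} (h : ∀ φ, inner ℂ φ (S φ) = inner ℂ φ (T φ)) :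
    S = T := by
  ext b
  refine ext_inner_left ℂ fun a => ?_
  rw [← polar_inner S, ← polar_inner T]
  simp only [h]

theorem norm_polar_le {q : H → ℂ} {C : ℝ} (hC : ∀ φ, ‖q φ‖ ≤ C * ‖φ‖ ^ 2) {a b : H}
    (ha : ‖a‖ = 1) (hb : ‖b‖ = 1) : ‖polar q a b‖ ≤ 4 * C := by
  have h0 : 0 ≤ C := by simpa [ha] using (norm_nonneg _).trans (hC a)
  have hk : ∀ k : Fin 4, ‖Complex.I ^ (k : ℕ) / 4 * q (b + Complex.I ^ (k : ℕ) • a)‖ ≤ C := by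
    intro k
    have h2 : ‖b + Complex.I ^ (k : ℕ) • a‖ ≤ 2 := by
      refine (norm_add_le _ _).trans ?_
      rw [norm_smul, norm_pow, Complex.norm_I, one_pow, ha, hb]
      norm_num
    have h4 : ‖b + Complex.I ^ (k : ℕ) • a‖ ^ 2 ≤ 4 := by
      nlinarith [norm_nonneg (b + Complex.I ^ (k : ℕ) • a)]
    have := (hC (b + Complex.I ^ (k : ℕ) • a)).trans (mul_le_mul_of_nonneg_left h4 h0)
    rw [norm_mul, norm_div, norm_pow, Complex.norm_I, one_pow, Complex.norm_ofNat]
    linarith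
  calc ‖polar q a b‖ ≤ ∑ k : Fin 4, C := norm_sum_le_of_le _ fun k _ => hk k
    _ = 4 * C := by simp

variable [CompleteSpace H]

/-- A bounded function on `H` that satisfies all linear identities between the values of
quadratic forms is the quadratic form of a bounded operator. -/
theorem exists_operator_of_quadratic {q : H → ℂ} {C : ℝ} (hC : ∀ φ, ‖q φ‖ ≤ C * ‖φ‖ ^ 2)
    (hq : ∀ (ι : Type) [Fintype ι] (c : ι → ℂ) (φ : ι → H),
      (∀ T : H →L[ℂ] H, ∑ i, c i * inner ℂ (φ i) (T (φ i)) = 0) → ∑ i, c i * q (φ i) = 0) :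
    ∃ T : H →L[ℂ] H, ∀ φ, inner ℂ φ (T φ) = q φ := by
  -- Expanding `polar` turns an identity between the values `⟨a, T b⟩` into one between quadratic
  -- values, indexed by `ι × Fin 4`. Sesquilinearity of `polar q` then follows because each of its
  -- rules is such an identity, valid for every `T`.
  have hpol (ι : Type) [Fintype ι] (c : ι → ℂ) (a b : ι → H)
      (h : ∀ T : H →L[ℂ] H, ∑ i, c i * inner ℂ (a i) (T (b i)) = 0) :
      ∑ i, c i * polar q (a i) (b i) = 0 := by
    have := hq (ι × Fin 4) (fun i => c i.1 * (Complex.I ^ (i.2 : ℕ) / 4))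
      (fun i => b i.1 + Complex.I ^ (i.2 : ℕ) • a i.1) fun T => by
        rw [← h T, Fintype.sum_prod_type]
        refine Finset.sum_congr rfl fun i _ => ?_
        rw [← polar_inner, polar, Finset.mul_sum]
        exact Finset.sum_congr rfl fun k _ => by ring
    rw [← this, Fintype.sum_prod_type]
    refine Finset.sum_congr rfl fun i _ => ?_
    rw [polar, Finset.mul_sum]
    exact Finset.sum_congr rfl fun k _ => by ring
  have hadd_left (a₁ a₂ b : H) : polar q (a₁ + a₂) b = polar q a₁ b + polar q a₂ b := by
    have := hpol (Fin 3) ![1, -1, -1] ![a₁ + a₂, a₁, a₂] (fun _ => b) fun T => by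
      simp [Fin.sum_univ_three]
    simp [Fin.sum_univ_three] at this
    linear_combination this
  have hadd_right (a b₁ b₂ : H) : polar q a (b₁ + b₂) = polar q a b₁ + polar q a b₂ := by
    have := hpol (Fin 3) ![1, -1, -1] (fun _ => a) ![b₁ + b₂, b₁, b₂] fun T => by
      simp [Fin.sum_univ_three]
    simp [Fin.sum_univ_three] at this
    linear_combination this
  have hsmul_left (c : ℂ) (a b : H) : polar q (c • a) b = (starRingEnd ℂ) c * polar q a b := by
    have := hpol (Fin 2) ![1, -(starRingEnd ℂ) c] ![c • a, a] (fun _ => b) fun T => by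
      simp [Fin.sum_univ_two, mul_comm]
    simp [Fin.sum_univ_two] at this
    linear_combination this
  have hsmul_right (c : ℂ) (a b : H) : polar q a (c • b) = c * polar q a b := by
    have := hpol (Fin 2) ![1, -c] (fun _ => a) ![c • b, b] fun T => by
      simp [Fin.sum_univ_two]
    simp [Fin.sum_univ_two] at this
    linear_combination this
  have hbound (a b : H) : ‖polar q a b‖ ≤ 4 * C * ‖a‖ * ‖b‖ := by
    rcases eq_or_ne a 0 with rfl | ha
    · have := hsmul_left 0 0 b
      simp only [zero_smul, map_zero, zero_mul] at this
      simp [this]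
    rcases eq_or_ne b 0 with rfl | hb
    · have := hsmul_right 0 a 0
      simp only [zero_smul, zero_mul] at this
      simp [this]
    have ha' : ‖a‖ ≠ 0 := norm_ne_zero_iff.2 ha
    have hb' : ‖b‖ ≠ 0 := norm_ne_zero_iff.2 hb
    have h := norm_polar_le hC (a := ((‖a‖⁻¹ : ℝ) : ℂ) • a) (b := ((‖b‖⁻¹ : ℝ) : ℂ) • b)
      (by rw [norm_smul, Complex.norm_real, norm_inv, norm_norm, inv_mul_cancel₀ ha'])
      (by rw [norm_smul, Complex.norm_real, norm_inv, norm_norm, inv_mul_cancel₀ hb'])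
    rw [hsmul_left, hsmul_right, norm_mul, norm_mul, RCLike.norm_conj, Complex.norm_real,
      Complex.norm_real, norm_inv, norm_norm, norm_inv, norm_norm] at h
    have hpos : 0 ≤ ‖a‖ * ‖b‖ := by positivity
    calc ‖polar q a b‖ = ‖a‖ * ‖b‖ * (‖a‖⁻¹ * (‖b‖⁻¹ * ‖polar q a b‖)) := by field_simp
      _ ≤ ‖a‖ * ‖b‖ * (4 * C) := mul_le_mul_of_nonneg_left h hpos
      _ = 4 * C * ‖a‖ * ‖b‖ := by ring
  let B : H →L⋆[ℂ] H →L[ℂ] ℂ :=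
    LinearMap.mkContinuous₂ (LinearMap.mk₂'ₛₗ (starRingEnd ℂ) (RingHom.id ℂ) (polar q)
      hadd_left hsmul_left hadd_right hsmul_right) (4 * C) hbound
  -- The operator representing the form `B` stands in the first slot of the inner product; the
  -- adjoint moves it to the second.
  refine ⟨ContinuousLinearMap.adjoint (InnerProductSpace.continuousLinearMapOfBilin B),
    fun φ => ?_⟩
  rw [ContinuousLinearMap.adjoint_inner_right, InnerProductSpace.continuousLinearMapOfBilin_apply]
  change polar q φ φ = q φ
  -- That the polarized form restricts to `q` on the diagonal is itself a linear identity for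
  -- quadratic forms: four polarization terms, and `none` for `-q φ`.
  have := hq (Option (Fin 4)) (fun o => o.elim (-1) fun k => Complex.I ^ (k : ℕ) / 4)
    (fun o => o.elim φ fun k => φ + Complex.I ^ (k : ℕ) • φ) fun T => by
      rw [Fintype.sum_option]
      have := polar_inner T φ φ
      rw [polar] at this
      simp only [Option.elim]
      rw [this]
      ring
  rw [Fintype.sum_option] at this
  simp only [Option.elim] at this
  rw [polar]
  linear_combination this

end Polar

/-! ### Bochner's theorem -/

set_option linter.unusedSectionVars false

section Bochner

open Filter Topology

variable {V : Type*} [NormedAddCommGroup V] [InnerProductSpace ℝ V] [FiniteDimensional ℝ V]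
  [MeasurableSpace V] [BorelSpace V]

theorem integrable_exp_neg_mul_norm_sq {a : ℝ} (ha : 0 < a) :
    Integrable fun s : V => Real.exp (-a * ‖s‖ ^ 2) := by
  have h := (GaussianFourier.integrable_cexp_neg_mul_sq_norm_add (V := V)
    (b := (a : ℂ)) (by simpa using ha) 0 0).re
  refine h.congr (Eventually.of_forall fun s => ?_)
  simp only [inner_zero_left, Complex.ofReal_zero, mul_zero, add_zero]
  rw [show -(a : ℂ) * (‖s‖ : ℂ) ^ 2 = ((-a * ‖s‖ ^ 2 : ℝ) : ℂ) by push_cast; ring]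
  exact Complex.exp_ofReal_re _

theorem integral_exp_neg_mul_norm_sq_pos {a : ℝ} (ha : 0 < a) :
    0 < ∫ s : V, Real.exp (-a * ‖s‖ ^ 2) := by
  rw [GaussianFourier.integral_rexp_neg_mul_sq_norm ha]
  positivity

variable {H : Type*} [NormedAddCommGroup H] [InnerProductSpace ℂ H] [CompleteSpace H]

/-- The Fourier transform of `s ↦ exp(-a ‖s‖²) ψ(s)`. -/
def gaussTransform (a : ℝ) (ψ : V → H) (x : V) : H :=
  ∫ s, ((Real.exp (-a * ‖s‖ ^ 2) : ℂ) * Complex.exp (-(inner ℝ s x : ℝ) * Complex.I)) • ψ s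

variable {ψ : V → H} {f : V → ℂ}

theorem norm_gaussTransform_integrand (hn : ∀ s, ‖ψ s‖ = 1) (a : ℝ) (x s : V) :
    ‖((Real.exp (-a * ‖s‖ ^ 2) : ℂ) * Complex.exp (-(inner ℝ s x : ℝ) * Complex.I)) • ψ s‖ =
      Real.exp (-a * ‖s‖ ^ 2) := by
  rw [norm_smul, norm_mul, hn, ← Complex.ofReal_neg, Complex.norm_exp_ofReal_mul_I,
    Complex.norm_real, Real.norm_eq_abs, Real.abs_exp, mul_one, mul_one]

theorem integrable_gaussTransform (hψ : Continuous ψ) (hn : ∀ s, ‖ψ s‖ = 1) {a : ℝ} (ha : 0 < a)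
    (x : V) : Integrable fun s =>
      ((Real.exp (-a * ‖s‖ ^ 2) : ℂ) * Complex.exp (-(inner ℝ s x : ℝ) * Complex.I)) • ψ s := by
  refine (integrable_exp_neg_mul_norm_sq ha).mono' ?_
    (Eventually.of_forall fun s => (norm_gaussTransform_integrand hn a x s).le)
  refine Continuous.aestronglyMeasurable ?_
  fun_prop

theorem norm_gaussTransform_le (hn : ∀ s, ‖ψ s‖ = 1) (a : ℝ) (x : V) :
    ‖gaussTransform a ψ x‖ ≤ ∫ s : V, Real.exp (-a * ‖s‖ ^ 2) := by
  refine (norm_integral_le_integral_norm _).trans_eq ?_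
  exact integral_congr_ae (Eventually.of_forall fun s => norm_gaussTransform_integrand hn a x s)

theorem continuous_gaussTransform (hψ : Continuous ψ) (hn : ∀ s, ‖ψ s‖ = 1) {a : ℝ} (ha : 0 < a) :
    Continuous (gaussTransform a ψ) := by
  refine continuous_of_dominated (bound := fun s => Real.exp (-a * ‖s‖ ^ 2)) (fun x => ?_)
    (fun x => Eventually.of_forall fun s => (norm_gaussTransform_integrand hn a x s).le)
    (integrable_exp_neg_mul_norm_sq ha) (Eventually.of_forall fun s => ?_)
  · exact (integrable_gaussTransform hψ hn ha x).1
  · fun_prop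

/-- Completing the square in `s` separates the two variables, so that a translation integrates `s`
out. -/
theorem exp_norm_sub_sq_mul (a : ℝ) (s u : V) :
    Real.exp (-a * ‖s - u‖ ^ 2) * Real.exp (-a * ‖s‖ ^ 2) =
      Real.exp (-(a / 2) * ‖u‖ ^ 2) * Real.exp (-(2 * a) * ‖s - (1 / 2 : ℝ) • u‖ ^ 2) := by
  rw [← Real.exp_add, ← Real.exp_add]
  congr 1
  rw [@norm_sub_sq_real, @norm_sub_sq_real, norm_smul, real_inner_smul_right]
  norm_num
  ring

theorem exp_norm_sub_sq_mul_le {a : ℝ} (ha : 0 < a) (s u : V) :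
    Real.exp (-a * ‖s - u‖ ^ 2) * Real.exp (-a * ‖s‖ ^ 2) ≤
      Real.exp (-(a / 2) * ‖s‖ ^ 2) * Real.exp (-(a / 4) * ‖u‖ ^ 2) := by
  rw [← Real.exp_add, ← Real.exp_add]
  refine Real.exp_le_exp.2 ?_
  have h : ‖u‖ ^ 2 ≤ 2 * ‖s - u‖ ^ 2 + 2 * ‖s‖ ^ 2 := by
    have h1 : ‖u‖ ≤ ‖s - u‖ + ‖s‖ := by
      simpa using norm_sub_le (s - u) s
    nlinarith [norm_nonneg u, sq_nonneg (‖s - u‖ - ‖s‖)]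
  nlinarith [sq_nonneg ‖s - u‖]

/-- This is where positive definiteness enters: the Fourier transform of the damped `f` is, up to a
positive constant, a squared norm and hence nonnegative. Expand the square as a double integral,
substitute `t = s - u`, and integrate out the Gaussian in `s`. -/
theorem norm_sq_gaussTransform (hψ : Continuous ψ) (hf : ∀ s t, inner ℂ (ψ t) (ψ s) = f (s - t))
    (hn : ∀ s, ‖ψ s‖ = 1) {a : ℝ} (ha : 0 < a) (x : V) :
    ((‖gaussTransform a ψ x‖ ^ 2 : ℝ) : ℂ) =
      ((∫ s : V, Real.exp (-(2 * a) * ‖s‖ ^ 2) : ℝ) : ℂ) *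
        ∫ u : V, (Real.exp (-(a / 2) * ‖u‖ ^ 2) : ℂ) *
          (Complex.exp (-(inner ℝ u x : ℝ) * Complex.I) * f u) := by
  have hfc : Continuous f := by
    have : f = fun s => inner ℂ (ψ 0) (ψ s) := by
      funext s
      rw [hf, sub_zero]
    rw [this]
    fun_prop
  have hfn : ∀ u, ‖f u‖ ≤ 1 := fun u => by
    have := norm_inner_le_norm (𝕜 := ℂ) (ψ 0) (ψ u)
    rwa [hf, hn, hn, sub_zero, mul_one] at this
  set k : V → ℂ := fun s =>
    (Real.exp (-a * ‖s‖ ^ 2) : ℂ) * Complex.exp (-(inner ℝ s x : ℝ) * Complex.I) with hk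
  have hint := integrable_gaussTransform hψ hn ha x
  have hstep (v : H) : inner ℂ (gaussTransform a ψ x) v = ∫ t, inner ℂ (k t • ψ t) v := by
    rw [← inner_conj_symm, gaussTransform, ← integral_inner hint, ← integral_conj]
    simp only [inner_conj_symm, hk]
  have h1 : ((‖gaussTransform a ψ x‖ ^ 2 : ℝ) : ℂ) =
      ∫ s, ∫ t, (starRingEnd ℂ) (k t) * k s * f (s - t) := by
    have h0 := inner_self_eq_norm_sq_to_K (𝕜 := ℂ) (gaussTransform a ψ x)
    rw [Complex.ofReal_pow]
    refine h0.symm.trans ?_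
    conv_lhs => rw [show inner ℂ (gaussTransform a ψ x) (gaussTransform a ψ x) =
      inner ℂ (gaussTransform a ψ x) (∫ s, k s • ψ s) from rfl]
    rw [← integral_inner hint]
    refine integral_congr_ae (Eventually.of_forall fun s => ?_)
    beta_reduce
    rw [hstep]
    refine integral_congr_ae (Eventually.of_forall fun t => ?_)
    simp only [inner_smul_left, inner_smul_right, hf]
    ring
  have hkk (s u : V) : (starRingEnd ℂ) (k (s - u)) * k s * f u =
      ((Real.exp (-a * ‖s - u‖ ^ 2) * Real.exp (-a * ‖s‖ ^ 2) : ℝ) : ℂ) *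
        (Complex.exp (-(inner ℝ u x : ℝ) * Complex.I) * f u) := by
    have : (starRingEnd ℂ) (Complex.exp (-(inner ℝ (s - u) x : ℝ) * Complex.I)) *
        Complex.exp (-(inner ℝ s x : ℝ) * Complex.I) =
        Complex.exp (-(inner ℝ u x : ℝ) * Complex.I) := by
      rw [← Complex.exp_conj, ← Complex.exp_add, inner_sub_left]
      congr 1
      simp only [map_mul, map_neg, Complex.conj_ofReal, Complex.conj_I]
      push_cast
      ring
    rw [← this]
    simp only [hk, map_mul, Complex.conj_ofReal]
    push_cast
    ring
  have h2 : ∫ s, ∫ t, (starRingEnd ℂ) (k t) * k s * f (s - t) =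
      ∫ s, ∫ u, ((Real.exp (-a * ‖s - u‖ ^ 2) * Real.exp (-a * ‖s‖ ^ 2) : ℝ) : ℂ) *
        (Complex.exp (-(inner ℝ u x : ℝ) * Complex.I) * f u) := by
    congr 1
    funext s
    rw [← integral_sub_left_eq_self (fun t => (starRingEnd ℂ) (k t) * k s * f (s - t)) volume s]
    congr 1
    funext u
    rw [sub_sub_cancel, hkk]
  rw [h1, h2, integral_integral_swap]
  · rw [← integral_const_mul]
    congr 1
    funext u
    rw [integral_mul_const, integral_complex_ofReal]
    simp only [exp_norm_sub_sq_mul]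
    rw [integral_const_mul,
      integral_sub_right_eq_self (fun s : V => Real.exp (-(2 * a) * ‖s‖ ^ 2))]
    push_cast
    ring
  · refine ((integrable_exp_neg_mul_norm_sq (V := V) (half_pos ha)).mul_prod
      (integrable_exp_neg_mul_norm_sq (V := V) (a := a / 4) (by positivity))).mono' ?_
      (Eventually.of_forall fun z => ?_)
    · refine Continuous.aestronglyMeasurable ?_
      simp only [Function.uncurry_def]
      fun_prop
    · simp only [Function.uncurry_def]
      rw [norm_mul, norm_mul, ← Complex.ofReal_neg, Complex.norm_exp_ofReal_mul_I,
        Complex.norm_real, Real.norm_eq_abs, abs_of_nonneg (by positivity), one_mul]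
      refine (mul_le_of_le_one_right (by positivity) (hfn _)).trans ?_
      exact exp_norm_sub_sq_mul_le ha z.1 z.2

/-- The nonnegative transform of the damped `f` need not be known to be integrable, so it is
multiplied by a further Gaussian and used as a density. On the Fourier side this smooths the damped
`f` over distance `r`, and both regularizations disappear as `r → 0`. -/
theorem exists_measure_charFun_eq_gaussian_average (hψ : Continuous ψ)
    (hf : ∀ s t, inner ℂ (ψ t) (ψ s) = f (s - t)) (hn : ∀ s, ‖ψ s‖ = 1) {r : ℝ} (hr : 0 < r) :
    ∃ (μ : Measure V) (K : ℂ), IsFiniteMeasure μ ∧ K ≠ 0 ∧ ∀ q, charFun μ q =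
      K * ∫ y : V, (Real.exp (-(r / 2) * ‖q + r • y‖ ^ 2) : ℂ) * f (q + r • y) *
        (Real.exp (-1 * ‖y‖ ^ 2) : ℂ) := by
  have hfc : Continuous f := by
    have : f = fun s => inner ℂ (ψ 0) (ψ s) := by
      funext s
      rw [hf, sub_zero]
    rw [this]
    fun_prop
  have hfn : ∀ u, ‖f u‖ ≤ 1 := fun u => by
    have := norm_inner_le_norm (𝕜 := ℂ) (ψ 0) (ψ u)
    rwa [hf, hn, hn, sub_zero, mul_one] at this
  set b : ℝ := r ^ 2 / 4 with hb
  have hb0 : 0 < b := by positivity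
  set D : V → ℝ := fun x => ‖gaussTransform r ψ x‖ ^ 2 * Real.exp (-b * ‖x‖ ^ 2) with hD
  have hDc : Continuous D := by
    have := continuous_gaussTransform hψ hn hr
    fun_prop
  have hD0 : ∀ x, 0 ≤ D x := fun x => by positivity
  have hDint : Integrable D := by
    refine ((integrable_exp_neg_mul_norm_sq (V := V) hb0).const_mul
      ((∫ s : V, Real.exp (-r * ‖s‖ ^ 2)) ^ 2)).mono' hDc.aestronglyMeasurable
      (Eventually.of_forall fun x => ?_)
    rw [Real.norm_eq_abs, abs_of_nonneg (hD0 x)]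
    exact mul_le_mul_of_nonneg_right
      (pow_le_pow_left₀ (norm_nonneg _) (norm_gaussTransform_le hn r x) 2) (Real.exp_pos _).le
  set Ca : ℝ := ∫ s : V, Real.exp (-(2 * r) * ‖s‖ ^ 2) with hCa
  have hCa0 : 0 < Ca := integral_exp_neg_mul_norm_sq_pos (by positivity)
  set P : ℂ := (Real.pi / (b : ℂ)) ^ (Module.finrank ℝ V / 2 : ℂ) with hP
  have hP0 : P ≠ 0 := by
    rw [hP, Complex.cpow_ne_zero_iff]
    left
    exact div_ne_zero (by exact_mod_cast Real.pi_ne_zero) (by exact_mod_cast hb0.ne')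
  have hrd : ((r ^ Module.finrank ℝ V : ℝ) : ℂ) ≠ 0 := by
    exact_mod_cast (pow_pos hr _).ne'
  refine ⟨volume.withDensity fun x => ENNReal.ofReal (D x),
    Ca * P * ((r ^ Module.finrank ℝ V : ℝ) : ℂ), isFiniteMeasure_withDensity_ofReal hDint.2,
    mul_ne_zero (mul_ne_zero (by exact_mod_cast hCa0.ne') hP0) hrd, fun q => ?_⟩
  rw [charFun_apply, integral_withDensity_ofReal hDc.measurable hD0]
  have h1 (x : V) : (D x : ℂ) * Complex.exp ((inner ℝ x q : ℝ) * Complex.I) =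
      Ca * ∫ u : V, (Real.exp (-b * ‖x‖ ^ 2) : ℂ) * Complex.exp ((inner ℝ x q : ℝ) * Complex.I) *
        ((Real.exp (-(r / 2) * ‖u‖ ^ 2) : ℂ) *
          (Complex.exp (-(inner ℝ u x : ℝ) * Complex.I) * f u)) := by
    rw [hD, Complex.ofReal_mul, norm_sq_gaussTransform hψ hf hn hr, integral_const_mul]
    ring
  simp only [h1]
  rw [integral_const_mul, integral_integral_swap]
  · have h2 (u : V) : ∫ x : V, (Real.exp (-b * ‖x‖ ^ 2) : ℂ) *
        Complex.exp ((inner ℝ x q : ℝ) * Complex.I) * ((Real.exp (-(r / 2) * ‖u‖ ^ 2) : ℂ) *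
          (Complex.exp (-(inner ℝ u x : ℝ) * Complex.I) * f u)) =
        P * ((Real.exp (-(r / 2) * ‖u‖ ^ 2) : ℂ) * f u *
          (Real.exp (-(1 / r ^ 2) * ‖u - q‖ ^ 2) : ℂ)) := by
      have h3 := GaussianFourier.integral_cexp_neg_mul_sq_norm_add (V := V) (b := (b : ℂ))
        (by simpa using hb0) Complex.I (q - u)
      have h4 : Complex.exp (Complex.I ^ 2 * (‖q - u‖ : ℂ) ^ 2 / (4 * b)) =
          (Real.exp (-(1 / r ^ 2) * ‖u - q‖ ^ 2) : ℂ) := by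
        rw [Complex.ofReal_exp, norm_sub_rev u q, hb]
        congr 1
        push_cast
        rw [Complex.I_sq]
        have : (r : ℂ) ≠ 0 := by exact_mod_cast hr.ne'
        field_simp
      rw [h4] at h3
      have h5 : ∀ x : V, (Real.exp (-b * ‖x‖ ^ 2) : ℂ) *
          Complex.exp ((inner ℝ x q : ℝ) * Complex.I) * ((Real.exp (-(r / 2) * ‖u‖ ^ 2) : ℂ) *
          (Complex.exp (-(inner ℝ u x : ℝ) * Complex.I) * f u)) =
          ((Real.exp (-(r / 2) * ‖u‖ ^ 2) : ℂ) * f u) *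
          Complex.exp (-(b : ℂ) * (‖x‖ : ℂ) ^ 2 + Complex.I * ((inner ℝ (q - u) x : ℝ) : ℂ)) := by
        intro x
        have : Complex.exp (-(b : ℂ) * (‖x‖ : ℂ) ^ 2 +
            Complex.I * ((inner ℝ (q - u) x : ℝ) : ℂ)) = (Real.exp (-b * ‖x‖ ^ 2) : ℂ) *
          Complex.exp ((inner ℝ x q : ℝ) * Complex.I) *
          Complex.exp (-(inner ℝ u x : ℝ) * Complex.I) := by
          rw [Complex.ofReal_exp, ← Complex.exp_add, ← Complex.exp_add, inner_sub_left,
            real_inner_comm x q]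
          congr 1
          push_cast
          ring
        rw [this]
        ring
      simp only [h5]
      rw [integral_const_mul, h3]
      ring
    simp only [h2]
    rw [integral_const_mul, ← integral_add_left_eq_self _ q]
    simp only [add_sub_cancel_left]
    have h6 := Measure.integral_comp_smul (volume : Measure V) (fun w : V =>
      (Real.exp (-(r / 2) * ‖q + w‖ ^ 2) : ℂ) * f (q + w) *
          (Real.exp (-(1 / r ^ 2) * ‖w‖ ^ 2) : ℂ)) r
    have h7 (y : V) : -(1 / r ^ 2) * ‖r • y‖ ^ 2 = -1 * ‖y‖ ^ 2 := by
      rw [norm_smul, Real.norm_eq_abs, mul_pow, sq_abs]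
      field_simp
    simp only [h7] at h6
    rw [h6, abs_of_pos (by positivity), Complex.real_smul, Complex.ofReal_inv]
    field_simp
  · refine ((integrable_exp_neg_mul_norm_sq (V := V) hb0).mul_prod
      (integrable_exp_neg_mul_norm_sq (V := V) (half_pos hr))).mono' ?_
      (Eventually.of_forall fun z => ?_)
    · refine Continuous.aestronglyMeasurable ?_
      simp only [Function.uncurry_def]
      fun_prop
    · simp only [Function.uncurry_def]
      rw [norm_mul, norm_mul, norm_mul, norm_mul, ← Complex.ofReal_neg,
        Complex.norm_exp_ofReal_mul_I, Complex.norm_exp_ofReal_mul_I,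
        Complex.norm_real, Real.norm_eq_abs, Real.abs_exp, Complex.norm_real, Real.norm_eq_abs,
        Real.abs_exp, one_mul, mul_one]
      exact mul_le_mul_of_nonneg_left (mul_le_of_le_one_right (Real.exp_pos _).le (hfn _))
        (Real.exp_pos _).le

theorem tendsto_gaussian_average (hfc : Continuous f) (hfn : ∀ u, ‖f u‖ ≤ 1) {r : ℕ → ℝ}
    (hr : ∀ n, 0 ≤ r n) (hr0 : Tendsto r atTop (𝓝 0)) (q : V) :
    Tendsto (fun n => ∫ y : V, (Real.exp (-(r n / 2) * ‖q + r n • y‖ ^ 2) : ℂ) *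
      f (q + r n • y) * (Real.exp (-1 * ‖y‖ ^ 2) : ℂ)) atTop
      (𝓝 (f q * ((∫ y : V, Real.exp (-1 * ‖y‖ ^ 2) : ℝ) : ℂ))) := by
  rw [← integral_complex_ofReal, ← integral_const_mul]
  refine tendsto_integral_of_dominated_convergence (fun y : V => Real.exp (-1 * ‖y‖ ^ 2))
    (fun n => ?_) (integrable_exp_neg_mul_norm_sq one_pos) (fun n => ?_) ?_
  · refine Continuous.aestronglyMeasurable ?_
    fun_prop
  · refine Eventually.of_forall fun y => ?_
    rw [norm_mul, norm_mul, Complex.norm_real, Real.norm_eq_abs, Real.abs_exp, Complex.norm_real,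
      Real.norm_eq_abs, Real.abs_exp]
    refine mul_le_of_le_one_left (Real.exp_pos _).le ?_
    refine mul_le_one₀ (Real.exp_le_one_iff.2 ?_) (norm_nonneg _) (hfn _)
    have := hr n
    have : 0 ≤ r n / 2 * ‖q + r n • y‖ ^ 2 := by positivity
    linarith
  · refine Eventually.of_forall fun y => ?_
    have hc : Continuous fun r : ℝ => (Real.exp (-(r / 2) * ‖q + r • y‖ ^ 2) : ℂ) *
      f (q + r • y) * (Real.exp (-1 * ‖y‖ ^ 2) : ℂ) := by fun_prop
    have := (hc.tendsto 0).comp hr0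
    simpa [Function.comp_def] using this

/-- If `f` is the pointwise limit of the characteristic functions of probability measures and is
continuous at `0`, then it is the characteristic function of a probability measure. -/
theorem exists_charFun_eq_of_tendsto {μ : ℕ → ProbabilityMeasure V} (hf : ContinuousAt f 0)
    (h : ∀ t, Tendsto (fun n => charFun (μ n : Measure V) t) atTop (𝓝 (f t))) :
    ∃ ν : Measure V, IsProbabilityMeasure ν ∧ ∀ t, charFun ν t = f t := by
  have ht := isTightMeasureSet_of_tendsto_charFun (μ := fun n => (μ n : Measure V)) hf h
  have hc : IsCompact (closure (Set.range μ)) := by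
    refine isCompact_closure_of_isTightMeasureSet ?_
    convert ht
    ext κ
    simp
  -- Tightness makes the closure compact; an ultrafilter finer than `atTop` has a limit there, so no
  -- subsequence need be extracted.
  let U : Ultrafilter ℕ := Ultrafilter.of atTop
  obtain ⟨ν, -, hν⟩ := hc.ultrafilter_le_nhds (U.map μ)
    (le_principal_iff.2 (Ultrafilter.mem_map.2
      (univ_mem' fun n => subset_closure (Set.mem_range_self n))))
  refine ⟨ν, inferInstance, fun t => ?_⟩
  have hcont : Continuous fun κ : ProbabilityMeasure V => charFun (κ : Measure V) t := by
    rw [continuous_iff_continuousAt]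
    intro κ
    have := (ProbabilityMeasure.tendsto_iff_forall_integral_rclike_tendsto ℂ
      (F := 𝓝 κ) (μs := id) (μ := κ)).1 tendsto_id (BoundedContinuousFunction.innerProbChar t)
    simpa only [ContinuousAt, charFun_eq_integral_innerProbChar, id_eq] using this
  exact tendsto_nhds_unique ((hcont.tendsto ν).comp hν) ((h t).mono_left (Ultrafilter.of_le _))

/-- **Bochner's theorem**, for a positive definite function with a given Gram representation. -/
theorem exists_charFun_eq (hψ : Continuous ψ) (hf : ∀ s t, inner ℂ (ψ t) (ψ s) = f (s - t))
    (h1 : f 0 = 1) : ∃ ν : Measure V, IsProbabilityMeasure ν ∧ ∀ t, charFun ν t = f t := by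
  have hn : ∀ s, ‖ψ s‖ = 1 := fun s => by
    have h := inner_self_eq_norm_sq_to_K (𝕜 := ℂ) (ψ s)
    rw [hf, sub_self, h1] at h
    have h' : ‖ψ s‖ ^ 2 = 1 := by
      have := congrArg Complex.re h
      simpa [← Complex.ofReal_pow] using this.symm
    nlinarith [norm_nonneg (ψ s)]
  have hfc : Continuous f := by
    have : f = fun s => inner ℂ (ψ 0) (ψ s) := by
      funext s
      rw [hf, sub_zero]
    rw [this]
    fun_prop
  have hfn : ∀ u, ‖f u‖ ≤ 1 := fun u => by
    have := norm_inner_le_norm (𝕜 := ℂ) (ψ 0) (ψ u)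
    rwa [hf, hn, hn, sub_zero, mul_one] at this
  have hr (n : ℕ) : 0 < 1 / ((n : ℝ) + 1) := by positivity
  choose μ K hμ hK hch using fun n : ℕ =>
    exists_measure_charFun_eq_gaussian_average hψ hf hn (hr n)
  set A : ℕ → V → ℂ := fun n q =>
    ∫ y : V, (Real.exp (-(1 / ((n : ℝ) + 1) / 2) * ‖q + (1 / ((n : ℝ) + 1)) • y‖ ^ 2) : ℂ) *
      f (q + (1 / ((n : ℝ) + 1)) • y) * (Real.exp (-1 * ‖y‖ ^ 2) : ℂ) with hA
  set J : ℂ := ((∫ y : V, Real.exp (-1 * ‖y‖ ^ 2) : ℝ) : ℂ) with hJ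
  have hJ0 : J ≠ 0 := by
    rw [hJ]
    exact_mod_cast (integral_exp_neg_mul_norm_sq_pos (V := V) one_pos).ne'
  have hlim (q : V) : Tendsto (fun n => A n q) atTop (𝓝 (f q * J)) :=
    tendsto_gaussian_average hfc hfn (fun n => (hr n).le) tendsto_one_div_add_atTop_nhds_zero_nat q
  have hne : ∀ᶠ n in atTop, A n 0 ≠ 0 :=
    (hlim 0).eventually_ne (by rw [h1, one_mul]; exact hJ0)
  -- The total mass `K n * A n 0` is known to be nonzero only eventually, so the sequence starts at
  -- `m`. Normalizing cancels the constants `K n`.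
  obtain ⟨m, hm⟩ := eventually_atTop.1 hne
  have hmass (n : ℕ) : ((μ n).real Set.univ : ℂ) = K n * A n 0 := by
    rw [← charFun_zero, hch]
  have hnz (n : ℕ) : NeZero (μ (n + m)) := ⟨fun h0 => by
    have := hmass (n + m)
    rw [h0] at this
    simp only [measureReal_zero, Pi.zero_apply, Complex.ofReal_zero] at this
    exact mul_ne_zero (hK _) (hm _ (Nat.le_add_left _ _)) this.symm⟩
  let ν : ℕ → ProbabilityMeasure V := fun n =>
    ⟨(μ (n + m) Set.univ)⁻¹ • μ (n + m), inferInstance⟩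
  refine exists_charFun_eq_of_tendsto (μ := ν) hfc.continuousAt fun t => ?_
  have hν (n : ℕ) : charFun (ν n : Measure V) t = A (n + m) t / A (n + m) 0 := by
    have h2 := hmass (n + m)
    have : charFun (ν n : Measure V) t =
        ((((μ (n + m)).real Set.univ)⁻¹ : ℝ) : ℂ) * charFun (μ (n + m)) t := by
      rw [charFun_apply, charFun_apply]
      change ∫ x, _ ∂((μ (n + m) Set.univ)⁻¹ • μ (n + m)) = _
      rw [integral_smul_measure, ENNReal.toReal_inv, Complex.real_smul]
      rfl
    rw [this, Complex.ofReal_inv, h2, hch]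
    have := hK (n + m)
    have := hm (n + m) (Nat.le_add_left _ _)
    change (K (n + m) * A (n + m) 0)⁻¹ * (K (n + m) * A (n + m) t) = _
    field_simp
  simp only [hν]
  have := ((hlim t).div (hlim 0) (by rw [h1, one_mul]; exact hJ0)).comp (tendsto_add_atTop_nat m)
  rwa [h1, one_mul, mul_div_cancel_right₀ _ hJ0] at this

end Bochner

/-! ### Weyl operators -/

section Weyl

variable {N : ℕ}

/-- The symplectic form `xᵀ Ω y`. -/
def symp (x y : PhaseSpace N) : ℝ := x ⬝ᵥ (Omega N *ᵥ y)

theorem symp_eq (x y : PhaseSpace N) :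
    symp x y = ∑ j, x (0, j) * y (1, j) - ∑ j, x (1, j) * y (0, j) := by
  simp [symp, Omega, dotProduct, Matrix.mulVec, Fintype.sum_prod_type, Fin.sum_univ_two,
    Matrix.blockDiagonal_apply, Finset.sum_ite_eq, sub_eq_add_neg]

theorem symp_comm (x y : PhaseSpace N) : symp x y = -symp y x := by
  rw [symp_eq, symp_eq, neg_sub]
  congr 1 <;> exact Finset.sum_congr rfl fun _ _ => mul_comm _ _

theorem symp_self (x : PhaseSpace N) : symp x x = 0 := by
  have := symp_comm x x
  linarith

theorem symp_add_left (x y z : PhaseSpace N) : symp (x + y) z = symp x z + symp y z :=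
  add_dotProduct _ _ _

theorem symp_smul_right (c : ℝ) (x y : PhaseSpace N) : symp x (c • y) = c * symp x y := by
  rw [symp, Matrix.mulVec_smul, dotProduct_smul, smul_eq_mul, symp]

theorem symp_add_right (x y z : PhaseSpace N) : symp x (y + z) = symp x y + symp x z := by
  rw [symp, Matrix.mulVec_add, dotProduct_add, symp, symp]

theorem symp_neg_right (x y : PhaseSpace N) : symp x (-y) = -symp x y := by
  rw [symp, Matrix.mulVec_neg, dotProduct_neg, symp]

/-- The symplectic form on the range of `A` is given by `Aᵀ Ω A`. -/
theorem symp_mulVec {M : ℕ} (A : Matrix (PhaseIdx N) (Fin M) ℝ) (p q : Fin M → ℝ) :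
    symp (A *ᵥ p) (A *ᵥ q) = p ⬝ᵥ ((Aᵀ * Omega N * A) *ᵥ q) := by
  rw [symp, ← Matrix.mulVec_mulVec, ← Matrix.mulVec_mulVec, Matrix.dotProduct_mulVec p Aᵀ,
    Matrix.vecMul_transpose]

/-- The phase `exp(-i s/2)`. -/
def halfPhase (s : ℝ) : ℂ := Complex.exp (((-(s / 2) : ℝ) : ℂ) * Complex.I)

theorem halfPhase_zero : halfPhase 0 = 1 := by
  simp [halfPhase]

theorem coeFn_weyl (x : PhaseSpace N) (ψ : Hilb N) : weyl x ψ =ᵐ[volume] weylFun x ψ :=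
  MemLp.coeFn_toLp (memLp_weylFun x ψ)

theorem weylPhase_mul (x y : PhaseSpace N) (t : Fin N → ℝ) :
    weylPhase x t * weylPhase y (t - fun j => x (0, j)) =
      halfPhase (symp x y) * weylPhase (x + y) t := by
  simp only [weylPhase, halfPhase, ← Complex.exp_add, ← add_mul, ← Complex.ofReal_add, symp_eq]
  congr 3
  simp only [Pi.add_apply, Pi.sub_apply, mul_sub, mul_add, add_mul, Finset.sum_sub_distrib,
    Finset.sum_add_distrib]
  have : ∑ j, y (1, j) * x (0, j) = ∑ j, x (0, j) * y (1, j) :=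
    Finset.sum_congr rfl fun _ _ => mul_comm _ _
  rw [this]
  ring

theorem weyl_weyl (x y : PhaseSpace N) (ψ : Hilb N) :
    weyl x (weyl y ψ) = halfPhase (symp x y) • weyl (x + y) ψ := by
  refine Lp.ext ?_
  have h1 := (coeFn_weyl x (weyl y ψ)).trans (weylFun_congr x (coeFn_weyl y ψ))
  have h2 := Lp.coeFn_smul (halfPhase (symp x y)) (weyl (x + y) ψ)
  filter_upwards [h1, h2, coeFn_weyl (x + y) ψ] with t h1 h2 h3
  rw [h1, h2, Pi.smul_apply, h3, smul_eq_mul, weylFun, weylFun, weylFun, ← mul_assoc, ← mul_assoc,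
    weylPhase_mul, sub_sub]
  rfl

theorem weyl_zero_apply (ψ : Hilb N) : weyl 0 ψ = ψ := by
  refine Lp.ext ?_
  filter_upwards [coeFn_weyl 0 ψ] with t h
  rw [h, weylFun]
  have h1 : weylPhase (0 : PhaseSpace N) t = 1 := by simp [weylPhase]
  have h2 : (t - fun j => (0 : PhaseSpace N) (0, j)) = t := by
    funext j
    simp
  rw [h1, h2, one_mul]

theorem norm_weyl (x : PhaseSpace N) (ψ : Hilb N) : ‖weyl x ψ‖ = ‖ψ‖ := by
  change ‖(memLp_weylFun x ψ).toLp _‖ = ‖ψ‖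
  rw [Lp.norm_toLp, eLpNorm_weylFun, Lp.norm_def]

theorem inner_weyl_weyl (x : PhaseSpace N) (φ ψ : Hilb N) :
    inner ℂ (weyl x φ) (weyl x ψ) = inner ℂ φ ψ :=
  (LinearMap.norm_map_iff_inner_map_map (weyl x)).1 (norm_weyl x) φ ψ

theorem weyl_weyl_neg (x : PhaseSpace N) (ψ : Hilb N) : weyl x (weyl (-x) ψ) = ψ := by
  rw [weyl_weyl, symp_neg_right, symp_self, neg_zero, halfPhase_zero, one_smul, add_neg_cancel,
    weyl_zero_apply]

theorem inner_weyl_left (x : PhaseSpace N) (φ ψ : Hilb N) :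
    inner ℂ (weyl x φ) ψ = inner ℂ φ (weyl (-x) ψ) := by
  rw [← inner_weyl_weyl x φ, weyl_weyl_neg]

/-- The momentum part of `x`. -/
def momentumPart (x : PhaseSpace N) : PhaseSpace N := fun i => if i.1 = 0 then 0 else x i

/-- The position part of `x`. -/
def positionPart (x : PhaseSpace N) : PhaseSpace N := fun i => if i.1 = 0 then x i else 0

theorem momentumPart_add_positionPart (x : PhaseSpace N) :
    momentumPart x + positionPart x = x := by
  funext i
  by_cases h : i.1 = 0 <;> simp [momentumPart, positionPart, h]

/-- Constant norm upgrades weak to strong continuity, since `‖F x - F x₀‖² = 2c² - 2 Re ⟨F x₀, F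
x⟩`. -/
theorem continuous_of_inner {X E : Type*} [TopologicalSpace X] [NormedAddCommGroup E]
    [InnerProductSpace ℂ E] {F : X → E} {c : ℝ} (hc : ∀ x, ‖F x‖ = c)
    (h : ∀ φ, Continuous fun x => inner ℂ φ (F x)) : Continuous F := by
  rw [continuous_iff_continuousAt]
  intro x₀
  rw [ContinuousAt, tendsto_iff_norm_sub_tendsto_zero]
  have h1 : ∀ x, ‖F x - F x₀‖ ^ 2 = 2 * c ^ 2 - 2 * (inner ℂ (F x₀) (F x)).re := by
    intro x
    have h2 := @norm_sub_sq ℂ E _ _ _ (F x) (F x₀)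
    rw [hc, hc, ← inner_conj_symm, RCLike.conj_re] at h2
    rw [h2]
    simp only [RCLike.re_to_complex]
    ring
  have h3 : Filter.Tendsto (fun x => ‖F x - F x₀‖ ^ 2) (nhds x₀) (nhds 0) := by
    simp only [h1]
    have h4 : (2 * c ^ 2 - 2 * (inner ℂ (F x₀) (F x₀)).re) = 0 := by
      rw [← h1 x₀]
      simp
    rw [← h4]
    have := Complex.continuous_re.comp (h (F x₀))
    have h5 : Continuous fun x => 2 * c ^ 2 - 2 * (inner ℂ (F x₀) (F x)).re := by fun_prop
    exact h5.tendsto x₀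
  have h6 := h3.sqrt
  simpa [Real.sqrt_sq] using h6

/-- A pure momentum shift multiplies by a phase, so dominated convergence applies to its matrix
elements. -/
theorem continuous_weyl_momentumPart (ψ : Hilb N) :
    Continuous fun x : PhaseSpace N => weyl (momentumPart x) ψ := by
  refine continuous_of_inner (fun x => norm_weyl _ ψ) fun φ => ?_
  have h1 (x : PhaseSpace N) : inner ℂ φ (weyl (momentumPart x) ψ) =
      ∫ t, weylPhase (momentumPart x) t * inner ℂ (φ t) (ψ t) := by
    rw [L2.inner_def]
    refine integral_congr_ae ?_
    filter_upwards [coeFn_weyl (momentumPart x) ψ] with t ht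
    have h2 : (t - fun j => momentumPart x (0, j)) = t := by
      funext j
      simp [momentumPart]
    rw [ht, weylFun, h2, ← smul_eq_mul, inner_smul_right]
  simp only [h1]
  have hint := L2.integrable_inner (𝕜 := ℂ) φ ψ
  refine continuous_of_dominated (bound := fun t => ‖(inner ℂ (φ t) (ψ t) : ℂ)‖) (fun x => ?_)
    (fun x => Filter.Eventually.of_forall fun t => ?_) hint.norm
    (Filter.Eventually.of_forall fun t => ?_)
  · exact (continuous_weylPhase _).aestronglyMeasurable.mul hint.1
  · rw [norm_mul, norm_weylPhase, one_mul]
  · refine Continuous.mul ?_ continuous_const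
    simp only [weylPhase, momentumPart]
    norm_num
    fun_prop

/-- A pure position shift is a translation, and translations act continuously on `L²`. -/
theorem continuous_weyl_positionPart (ψ : Hilb N) :
    Continuous fun x : PhaseSpace N => weyl (positionPart x) ψ := by
  let F : C(PhaseSpace N × (Fin N → ℝ), Fin N → ℝ) :=
    ⟨fun z => z.2 - fun j => z.1 (0, j), by fun_prop⟩
  have hmp (x : PhaseSpace N) : MeasurePreserving (F.curry x) volume volume :=
    measurePreserving_sub_right volume _
  have h1 (x : PhaseSpace N) : weyl (positionPart x) ψ =
      Lp.compMeasurePreserving (F.curry x) (hmp x) ψ := by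
    refine Lp.ext ?_
    filter_upwards [coeFn_weyl (positionPart x) ψ,
      Lp.coeFn_compMeasurePreserving ψ (hmp x)] with t h2 h3
    rw [h2, h3, weylFun]
    have h4 : weylPhase (positionPart x) t = 1 := by simp [weylPhase, positionPart]
    rw [h4, one_mul]
    rfl
  simp only [h1]
  exact continuous_const.compMeasurePreservingLp F.curry.continuous hmp (by simp)

/-- The Weyl operators are strongly continuous. -/
theorem continuous_weyl (ψ : Hilb N) : Continuous fun x : PhaseSpace N => weyl x ψ := by
  refine continuous_of_inner (fun x => norm_weyl _ ψ) fun φ => ?_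
  have hneg (x : PhaseSpace N) : -momentumPart x = momentumPart (-x) := by
    funext i
    by_cases h : i.1 = 0 <;> simp [momentumPart, h]
  -- Moving the momentum factor onto `φ` leaves an inner product of two vectors, each already known
  -- to depend continuously on `x`.
  have h1 (x : PhaseSpace N) : inner ℂ φ (weyl x ψ) =
      halfPhase (-symp (momentumPart x) (positionPart x)) *
        inner ℂ (weyl (momentumPart (-x)) φ) (weyl (positionPart x) ψ) := by
    have h2 := weyl_weyl (momentumPart x) (positionPart x) ψ
    rw [momentumPart_add_positionPart] at h2
    rw [← hneg, inner_weyl_left, neg_neg, h2, inner_smul_right, ← mul_assoc]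
    have : halfPhase (-symp (momentumPart x) (positionPart x)) *
        halfPhase (symp (momentumPart x) (positionPart x)) = 1 := by
      rw [halfPhase, halfPhase, ← Complex.exp_add, ← add_mul, ← Complex.ofReal_add,
        show ∀ s : ℝ, -(-s / 2) + -(s / 2) = 0 from fun s => by ring]
      simp
    rw [this, one_mul]
  simp only [h1]
  have h3 : Continuous fun x : PhaseSpace N => symp (momentumPart x) (positionPart x) := by
    simp only [symp_eq, momentumPart, positionPart]
    norm_num
    fun_prop
  refine Continuous.mul ?_ (Continuous.inner ?_ (continuous_weyl_positionPart ψ))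
  · unfold halfPhase
    fun_prop
  · exact (continuous_weyl_momentumPart φ).comp continuous_neg

end Weyl

/-! ### Integrals with respect to observables -/

theorem IsComplexFunctional.sum {α : Type*} [MeasurableSpace α] {ι : Type*} (s : Finset ι)
    {L : ι → (α → ℂ) → ℂ} (hL : ∀ i ∈ s, IsComplexFunctional (L i)) :
    IsComplexFunctional fun g => ∑ i ∈ s, L i g := by
  classical
  induction s using Finset.induction_on with
  | empty =>
    simp only [Finset.sum_empty]
    exact (show IsSignedFunctional (α := α) fun _ => 0 from
      ⟨0, 0, inferInstance, inferInstance, by simp⟩).isComplexFunctional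
  | insert i s hi ih =>
    simp only [Finset.sum_insert hi]
    exact (hL i (Finset.mem_insert_self i s)).add
      (ih fun j hj => hL j (Finset.mem_insert_of_mem hj))

theorem isComplexFunctional_polar {α H : Type*} [MeasurableSpace α] [NormedAddCommGroup H]
    [InnerProductSpace ℂ H] (ν : H → Measure α) [∀ φ, IsFiniteMeasure (ν φ)] (a b : H) :
    IsComplexFunctional fun g => polar (fun φ => ∫ x, g x ∂(ν φ)) a b :=
  IsComplexFunctional.sum _ fun _ _ => (isComplexFunctional_integral _).const_mul _

theorem inner_self_eq_ofReal {H : Type*} [NormedAddCommGroup H] [InnerProductSpace ℂ H] (φ : H) :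
    inner ℂ φ φ = ((‖φ‖ ^ 2 : ℝ) : ℂ) := by
  rw [inner_self_eq_norm_sq_to_K]
  push_cast
  rfl

theorem hasSum_measureReal_iUnion {α : Type*} [MeasurableSpace α] (μ : Measure α)
    [IsFiniteMeasure μ] {X : ℕ → Set α} (hX : ∀ k, MeasurableSet (X k))
    (hd : Pairwise (Function.onFun Disjoint X)) :
    HasSum (fun k => μ.real (X k)) (μ.real (⋃ k, X k)) := by
  have h := measure_iUnion (μ := μ) hd hX
  have hne : ∑' k, μ (X k) ≠ ⊤ := by
    rw [← h]
    finiteness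
  have h2 := ENNReal.hasSum_toReal hne
  rw [← ENNReal.tsum_toReal_eq fun k => by finiteness, ← h] at h2
  exact h2

namespace Observable

variable {N M : ℕ} (E : Observable N M)

theorem diagMeasure_apply (φ : Hilb N) {X : Set (Fin M → ℝ)} (hX : MeasurableSet X) :
    E.diagMeasure φ X = ENNReal.ofReal (inner ℂ φ (E.op X φ)).re :=
  Measure.ofMeasurable_apply X hX

instance (φ : Hilb N) : IsFiniteMeasure (E.diagMeasure φ) :=
  ⟨by rw [E.diagMeasure_apply φ MeasurableSet.univ]; exact ENNReal.ofReal_lt_top⟩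

theorem diagMeasure_real (φ : Hilb N) {X : Set (Fin M → ℝ)} (hX : MeasurableSet X) :
    ((E.diagMeasure φ).real X : ℂ) = inner ℂ φ (E.op X φ) := by
  have h := (E.op_positive X hX).inner_nonneg_right φ
  rw [Measure.real, E.diagMeasure_apply φ hX, ENNReal.toReal_ofReal (Complex.le_def.1 h).1]
  exact (Complex.eq_re_of_ofReal_le h).symm

theorem hasIntegral_indicator {X : Set (Fin M → ℝ)} (hX : MeasurableSet X) :
    E.HasIntegral (X.indicator fun _ => 1) (E.op X) := fun φ =>
  ⟨(isBddMeas_indicator hX).integrable _, by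
    rw [integral_indicator_one_complex _ hX, E.diagMeasure_real φ hX]⟩

/-- The functional `g ↦ ∫ g(x) ⟨a, E(dx) b⟩`. -/
def offDiag (a b : Hilb N) (g : (Fin M → ℝ) → ℂ) : ℂ :=
  polar (fun φ => ∫ x, g x ∂(E.diagMeasure φ)) a b

theorem isComplexFunctional_offDiag (a b : Hilb N) : IsComplexFunctional (E.offDiag a b) :=
  isComplexFunctional_polar E.diagMeasure a b

variable {E}

theorem HasIntegral.offDiag_eq {g : (Fin M → ℝ) → ℂ} {T : Hilb N →L[ℂ] Hilb N}
    (h : E.HasIntegral g T) (a b : Hilb N) : E.offDiag a b g = inner ℂ a (T b) := by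
  rw [← polar_inner, offDiag]
  simp only [(h _).2]

theorem op_isSelfAdjoint {X : Set (Fin M → ℝ)} (hX : MeasurableSet X) (a b : Hilb N) :
    inner ℂ (E.op X a) b = inner ℂ a (E.op X b) :=
  (E.op_positive X hX).isSymmetric a b

/-- An operator that commutes with an observable commutes with its integrals. -/
theorem HasIntegral.commute_of_commute_op {g : (Fin M → ℝ) → ℂ} {S T : Hilb N →L[ℂ] Hilb N}
    (hS : E.HasIntegral g S) (hg : IsBddMeas g)
    (hT : ∀ X, MeasurableSet X → T * E.op X = E.op X * T) : T * S = S * T := by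
  refine eq_of_inner_map fun φ => ?_
  -- Passing `T` to the left vector as its adjoint makes both `⟨φ, T E(X) φ⟩` and `⟨φ, E(X) T φ⟩`
  -- matrix elements of `E`, hence complex measures in `X`.
  have h := ((E.isComplexFunctional_offDiag (ContinuousLinearMap.adjoint T φ) φ).sub
    (E.isComplexFunctional_offDiag φ (T φ))).eq_zero_of_indicator (fun X hX => by
      rw [(E.hasIntegral_indicator hX).offDiag_eq, (E.hasIntegral_indicator hX).offDiag_eq,
        ContinuousLinearMap.adjoint_inner_left, sub_eq_zero]
      exact congrArg (fun R : Hilb N →L[ℂ] Hilb N => inner ℂ φ (R φ)) (hT X hX)) hg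
  rw [hS.offDiag_eq, hS.offDiag_eq, ContinuousLinearMap.adjoint_inner_left, sub_eq_zero] at h
  exact h

/-- An operator that commutes with the characteristic function of an observable commutes with the
observable. -/
theorem commute_op_of_commute_character {S : (Fin M → ℝ) → Hilb N →L[ℂ] Hilb N}
    {T : Hilb N →L[ℂ] Hilb N} (hS : ∀ p, E.HasIntegral (character p) (S p))
    (hT : ∀ p, T * S p = S p * T) {X : Set (Fin M → ℝ)} (hX : MeasurableSet X) :
    T * E.op X = E.op X * T := by
  refine eq_of_inner_map fun φ => ?_
  have h := ((E.isComplexFunctional_offDiag (ContinuousLinearMap.adjoint T φ) φ).sub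
    (E.isComplexFunctional_offDiag φ (T φ))).eq_zero_of_character (fun p => by
      rw [(hS p).offDiag_eq, (hS p).offDiag_eq,
        ContinuousLinearMap.adjoint_inner_left, sub_eq_zero]
      exact congrArg (fun R : Hilb N →L[ℂ] Hilb N => inner ℂ φ (R φ)) (hT p))
      (isBddMeas_indicator hX)
  rw [(E.hasIntegral_indicator hX).offDiag_eq, (E.hasIntegral_indicator hX).offDiag_eq,
    ContinuousLinearMap.adjoint_inner_left, sub_eq_zero] at h
  exact h

theorem ext_op {E F : Observable N M} (h : ∀ X, MeasurableSet X → E.op X = F.op X) : E = F := by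
  have hop : E.op = F.op := by
    funext X
    by_cases hX : MeasurableSet X
    · exact h X hX
    · rw [E.op_not_measurable X hX, F.op_not_measurable X hX]
  cases E
  cases F
  simp only at hop
  subst hop
  rfl

theorem ext_diagMeasure {E F : Observable N M} (h : ∀ φ, E.diagMeasure φ = F.diagMeasure φ) :
    E = F :=
  ext_op fun X hX => eq_of_inner_map fun φ => by
    rw [← E.diagMeasure_real φ hX, ← F.diagMeasure_real φ hX, h φ]

/-- A family of measures whose characteristic functions are quadratic forms is the family of
outcome distributions of an observable. -/
theorem exists_of_measures (ν : Hilb N → Measure (Fin M → ℝ)) [∀ φ, IsFiniteMeasure (ν φ)]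
    (U : (Fin M → ℝ) → Hilb N →L[ℂ] Hilb N) (hU0 : U 0 = 1)
    (hU : ∀ φ p, ∫ x, character p x ∂(ν φ) = inner ℂ φ (U p φ)) :
    ∃ Q : Observable N M, ∀ φ, Q.diagMeasure φ = ν φ := by
  have hmass (φ : Hilb N) : (ν φ).real Set.univ = ‖φ‖ ^ 2 := by
    have h := hU φ 0
    simp only [character_zero, hU0, one_apply_eq_self, inner_self_eq_ofReal,
      integral_const, Complex.real_smul, mul_one] at h
    exact_mod_cast h
  have hex (X : Set (Fin M → ℝ)) (hX : MeasurableSet X) :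
      ∃ T : Hilb N →L[ℂ] Hilb N, ∀ φ, inner ℂ φ (T φ) = ((ν φ).real X : ℂ) := by
    refine exists_operator_of_quadratic (C := 1) (fun φ => ?_) fun ι _ c φ h => ?_
    · rw [Complex.norm_real, Real.norm_eq_abs, abs_of_nonneg measureReal_nonneg, one_mul, ← hmass]
      exact measureReal_mono (Set.subset_univ X)
    -- A linear identity valid for all quadratic forms holds for each `U p`, so this combination of
    -- measures kills every character and therefore every indicator.
    · have hL : IsComplexFunctional fun g : (Fin M → ℝ) → ℂ =>
          ∑ i, c i * ∫ x, g x ∂(ν (φ i)) :=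
        IsComplexFunctional.sum _ fun i _ => (isComplexFunctional_integral _).const_mul _
      have := hL.eq_zero_of_character (fun p => by simp only [hU]; exact h (U p))
        (isBddMeas_indicator hX)
      simpa only [integral_indicator_one_complex _ hX] using this
  choose T hT using hex
  classical
  let op : Set (Fin M → ℝ) → (Hilb N →L[ℂ] Hilb N) :=
    fun X => if h : MeasurableSet X then T X h else 0
  have hop (X : Set (Fin M → ℝ)) (hX : MeasurableSet X) (φ : Hilb N) :
      inner ℂ φ (op X φ) = ((ν φ).real X : ℂ) := by
    simp only [op, dif_pos hX, hT]
  let Q : Observable N M :=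
    { op := op
      op_not_measurable := fun X hX => dif_neg hX
      op_positive := fun X hX => by
        rw [ContinuousLinearMap.isPositive_iff_complex]
        intro φ
        rw [← inner_conj_symm, hop X hX, Complex.conj_ofReal]
        simp
      op_univ := eq_of_inner_map fun φ => by
        rw [hop _ MeasurableSet.univ, hmass, one_apply_eq_self, inner_self_eq_ofReal]
      op_iUnion := fun X hX hd φ ψ => by
        simp only [← polar_inner, hop _ (hX _), hop _ (MeasurableSet.iUnion hX), polar]
        refine hasSum_sum fun k _ => HasSum.mul_left _ ?_
        refine Complex.hasSum_ofReal.2 ?_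
        exact hasSum_measureReal_iUnion _ hX hd }
  refine ⟨Q, fun φ => Measure.ext fun X hX => ?_⟩
  rw [← measureReal_eq_measureReal_iff (by finiteness) (by finiteness)]
  have := (Q.diagMeasure_real φ hX).trans (hop X hX φ)
  exact_mod_cast this

end Observable

/-! ### Parameters of Gaussian observables -/

section Parameters

variable {N M : ℕ} {A : Matrix (PhaseIdx N) (Fin M) ℝ} {B : Matrix (Fin M) (Fin M) ℝ}

theorem matrix_eq_zero_of_forall_dotProduct {K : Matrix (Fin M) (Fin M) ℝ}
    (h : ∀ p q, p ⬝ᵥ (K *ᵥ q) = 0) : K = 0 := by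
  ext i j
  have := h (Pi.single i 1) (Pi.single j 1)
  simpa using this

theorem symm_of_posSemidef (h : (B.map Complex.ofReal -
    Complex.I • (Aᵀ * Omega N * A).map Complex.ofReal).PosSemidef) (i j : Fin M) :
    B i j = B j i := by
  have := congrArg Complex.re (h.1.apply i j)
  simpa using this.symm

theorem posSemidef_of_isotropic (h : (B.map Complex.ofReal -
    Complex.I • (Aᵀ * Omega N * A).map Complex.ofReal).PosSemidef)
    (hA : Aᵀ * Omega N * A = 0) : B.PosSemidef := by
  refine Matrix.PosSemidef.of_dotProduct_mulVec_nonneg ?_ fun x => ?_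
  · ext i j
    simpa using symm_of_posSemidef h j i
  · have h1 := h.dotProduct_mulVec_nonneg fun i => (x i : ℂ)
    rw [hA] at h1
    have h2 : (star fun i => (x i : ℂ)) ⬝ᵥ ((B.map Complex.ofReal -
        Complex.I • (0 : Matrix (Fin M) (Fin M) ℝ).map Complex.ofReal) *ᵥ fun i => (x i : ℂ)) =
        ((star x ⬝ᵥ (B *ᵥ x) : ℝ) : ℂ) := by
      simp [dotProduct, Matrix.mulVec]
    rw [h2] at h1
    exact_mod_cast h1

theorem Omega_transpose : (Omega N)ᵀ = -Omega N := by
  rw [Omega, Matrix.blockDiagonal_transpose, ← Matrix.blockDiagonal_neg]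
  congr 1
  funext k
  ext i j
  fin_cases i <;> fin_cases j <;> simp

/-- The matrix `-i Aᵀ Ω A` has zero diagonal by antisymmetry, and a positive semidefinite matrix of
trace zero vanishes. -/
theorem isotropic_of_posSemidef_zero
    (h : ((0 : Matrix (Fin M) (Fin M) ℝ).map Complex.ofReal -
      Complex.I • (Aᵀ * Omega N * A).map Complex.ofReal).PosSemidef) :
    Aᵀ * Omega N * A = 0 := by
  set K := Aᵀ * Omega N * A with hK
  have hKT : Kᵀ = -K := by
    rw [hK, Matrix.transpose_mul, Matrix.transpose_mul, Omega_transpose, Matrix.transpose_transpose]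
    simp [Matrix.mul_assoc]
  have hd : ∀ i, K i i = 0 := fun i => by
    have := congrFun (congrFun hKT i) i
    simp only [Matrix.transpose_apply, Matrix.neg_apply] at this
    linarith
  have h0 := (h.trace_eq_zero_iff).1 (by simp [Matrix.trace, hd])
  ext i j
  have := congrFun (congrFun h0 i) j
  simpa using this

theorem symp_eq_zero_of_isotropic (hA : Aᵀ * Omega N * A = 0) (p q : Fin M → ℝ) :
    symp (A *ᵥ p) (A *ᵥ q) = 0 := by
  rw [symp_mulVec, hA, Matrix.zero_mulVec, dotProduct_zero]

theorem isotropic_of_symp (h : ∀ p q, symp (A *ᵥ p) (A *ᵥ q) = 0) : Aᵀ * Omega N * A = 0 :=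
  matrix_eq_zero_of_forall_dotProduct fun p q => by rw [← symp_mulVec, h]

theorem Omega_mul_self : Omega N * Omega N = -1 := by
  rw [Omega, ← Matrix.blockDiagonal_mul, ← Matrix.blockDiagonal_one, ← Matrix.blockDiagonal_neg]
  congr 1
  funext k
  ext i j
  fin_cases i <;> fin_cases j <;> simp

/-- From `Aᵀ (Ω A) = 0` the ranks of `Aᵀ` and `Ω A` add up to at most `2N`, and both equal `rank A`
because `Ω` is invertible. -/
theorem rank_le_of_isotropic (hA : Aᵀ * Omega N * A = 0) : A.rank ≤ N := by
  rw [Matrix.mul_assoc] at hA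
  have h := Matrix.rank_add_rank_le_card_of_mul_eq_zero hA
  have hu : IsUnit (Omega N).det := by
    rw [← Matrix.isUnit_iff_isUnit_det]
    exact ⟨⟨Omega N, -Omega N, by simp [Omega_mul_self], by simp [Omega_mul_self]⟩, rfl⟩
  rw [Matrix.rank_mul_eq_right_of_isUnit_det _ _ hu, Matrix.rank_transpose] at h
  simp at h
  omega

theorem gaussianFactor_zero (p : Fin M → ℝ) (v : Fin M → ℝ) :
    gaussianFactor 0 v p = Complex.exp (((-(v ⬝ᵥ p) : ℝ) : ℂ) * Complex.I) := by
  rw [gaussianFactor, Matrix.zero_mulVec, dotProduct_zero]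
  congr 1
  push_cast
  ring

theorem gaussianFactor_ne_zero (v p : Fin M → ℝ) : gaussianFactor B v p ≠ 0 :=
  Complex.exp_ne_zero _

theorem gaussianFactor_zero_add (v p q : Fin M → ℝ) :
    gaussianFactor 0 v (p + q) = gaussianFactor 0 v p * gaussianFactor 0 v q := by
  rw [gaussianFactor_zero, gaussianFactor_zero, gaussianFactor_zero, ← Complex.exp_add,
    dotProduct_add]
  push_cast
  ring_nf

theorem gaussianFactor_neg_mul (v p : Fin M → ℝ) :
    gaussianFactor B v (-p) * gaussianFactor B v p =
      Complex.exp ((-(1 / 2) * (p ⬝ᵥ (B *ᵥ p)) : ℝ) : ℂ) := by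
  rw [gaussianFactor, gaussianFactor, ← Complex.exp_add, Matrix.mulVec_neg, neg_dotProduct_neg,
    dotProduct_neg]
  push_cast
  ring_nf

theorem exists_hilb_norm_eq_one (N : ℕ) : ∃ φ : Hilb N, ‖φ‖ = 1 := by
  have hv : volume (Set.Icc (0 : Fin N → ℝ) 1) = 1 := by
    rw [Real.volume_Icc_pi]
    simp
  refine ⟨indicatorConstLp 2 (measurableSet_Icc (a := (0 : Fin N → ℝ)) (b := 1))
    (by rw [hv]; simp) (1 : ℂ), ?_⟩
  rw [norm_indicatorConstLp (by simp) (by simp), Measure.real, hv]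
  simp

end Parameters

/-! ### Existence and uniqueness -/

/-- The Gaussian probability measures exist. -/
theorem exists_isGaussianMeasureWith {M : ℕ} {B : Matrix (Fin M) (Fin M) ℝ} (hB : B.PosSemidef)
    (v : Fin M → ℝ) : ∃ μ : Measure (Fin M → ℝ), IsGaussianMeasureWith μ B v := by
  -- The convention `exp(-pᵀBp/4 - i vᵀp)` corresponds to mean `-v` and covariance `B/2`.
  set γ := ProbabilityTheory.multivariateGaussian (WithLp.toLp 2 (-v)) ((1 / 2 : ℝ) • B) with hγ
  have hm : Measurable (WithLp.ofLp : EuclideanSpace ℝ (Fin M) → Fin M → ℝ) :=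
    (MeasurableEquiv.toLp 2 _).symm.measurable
  refine ⟨γ.map WithLp.ofLp, ⟨Measure.isProbabilityMeasure_map hm.aemeasurable, hB, fun p => ?_⟩⟩
  rw [integral_map hm.aemeasurable (continuous_character p).aestronglyMeasurable]
  have h := ProbabilityTheory.charFun_multivariateGaussian (μ := WithLp.toLp 2 (-v))
    (hB.smul (show (0 : ℝ) ≤ 1 / 2 by norm_num)) (WithLp.toLp 2 p)
  rw [charFun_apply] at h
  have hc : ∀ x : EuclideanSpace ℝ (Fin M), character p x.ofLp =
      Complex.exp ((inner ℝ x (WithLp.toLp 2 p) : ℝ) * Complex.I) := by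
    intro x
    rw [EuclideanSpace.inner_eq_star_dotProduct]
    rfl
  simp only [hc]
  rw [h, gaussianFactor, EuclideanSpace.inner_eq_star_dotProduct]
  congr 1
  simp only [star_trivial, Matrix.smul_mulVec, dotProduct_smul, neg_dotProduct, smul_eq_mul]
  push_cast
  ring

namespace Observable

variable {N M : ℕ} {E : Observable N M} {A : Matrix (PhaseIdx N) (Fin M) ℝ}
  {B : Matrix (Fin M) (Fin M) ℝ} {v : Fin M → ℝ}

theorem IsGaussianWith.integral_character (hE : E.IsGaussianWith A B v) (φ : Hilb N)
    (p : Fin M → ℝ) : ∫ x, character p x ∂(E.diagMeasure φ) =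
      gaussianFactor B v p * inner ℂ φ (weyl (A *ᵥ p) φ) := by
  rw [← (hE.2 p φ).2, _root_.smul_apply, inner_smul_right]

theorem IsGaussianWith.unique {F : Observable N M} (hE : E.IsGaussianWith A B v)
    (hF : F.IsGaussianWith A B v) : E = F :=
  ext_diagMeasure fun φ => measure_ext_of_character fun p => by
    rw [hE.integral_character, hF.integral_character]

theorem weyl_isotropic (hA : Aᵀ * Omega N * A = 0) (p q : Fin M → ℝ) (φ : Hilb N) :
    weyl (A *ᵥ p) (weyl (A *ᵥ q) φ) = weyl (A *ᵥ (p + q)) φ := by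
  rw [weyl_weyl, symp_eq_zero_of_isotropic hA, halfPhase_zero, one_smul, Matrix.mulVec_add]

/-- Isotropy removes the phases from the Weyl relation, so the orbit of `φ` has inner products
depending only on `s - t`. This is the Gram representation needed for Bochner's theorem; normalizing
by `‖φ‖` is undone at the end by the factor `‖φ‖²`. -/
theorem exists_measure_weyl (hA : Aᵀ * Omega N * A = 0) (v : Fin M → ℝ) (φ : Hilb N) :
    ∃ ν : Measure (Fin M → ℝ), IsFiniteMeasure ν ∧ ∀ p, ∫ x, character p x ∂ν =
      gaussianFactor 0 v p * inner ℂ φ (weyl (A *ᵥ p) φ) := by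
  rcases eq_or_ne φ 0 with rfl | hφ
  · exact ⟨0, inferInstance, fun p => by simp⟩
  have hm : Measurable (WithLp.ofLp : EuclideanSpace ℝ (Fin M) → Fin M → ℝ) :=
    (MeasurableEquiv.toLp 2 _).symm.measurable
  have hφ' : (‖φ‖ : ℂ) ≠ 0 := by exact_mod_cast norm_ne_zero_iff.2 hφ
  let ψ : EuclideanSpace ℝ (Fin M) → Hilb N := fun s =>
    (gaussianFactor 0 v s.ofLp * (‖φ‖ : ℂ)⁻¹) • weyl (A *ᵥ s.ofLp) φ
  have hψ : Continuous ψ := by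
    have h1 : Continuous fun s : EuclideanSpace ℝ (Fin M) => weyl (A *ᵥ s.ofLp) φ :=
      (continuous_weyl φ).comp (by fun_prop)
    have h2 : Continuous fun s : EuclideanSpace ℝ (Fin M) => gaussianFactor 0 v s.ofLp := by
      simp only [gaussianFactor_zero, dotProduct]
      fun_prop
    exact (h2.mul continuous_const).smul h1
  let f : EuclideanSpace ℝ (Fin M) → ℂ := fun u =>
    gaussianFactor 0 v u.ofLp * inner ℂ φ (weyl (A *ᵥ u.ofLp) φ) * ((‖φ‖ : ℂ) ^ 2)⁻¹
  have hf : ∀ s t, inner ℂ (ψ t) (ψ s) = f (s - t) := by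
    intro s t
    simp only [ψ, f]
    rw [inner_smul_left, inner_smul_right, inner_weyl_left, ← Matrix.mulVec_neg,
      weyl_isotropic hA, WithLp.ofLp_sub, sub_eq_add_neg s.ofLp, add_comm s.ofLp,
      gaussianFactor_zero_add, map_mul, map_inv₀, Complex.conj_ofReal]
    have : (starRingEnd ℂ) (gaussianFactor 0 v t.ofLp) = gaussianFactor 0 v (-t.ofLp) := by
      rw [gaussianFactor_zero, gaussianFactor_zero, ← Complex.exp_conj, map_mul,
        Complex.conj_ofReal, Complex.conj_I, dotProduct_neg]
      push_cast
      ring_nf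
    rw [this]
    field_simp
  have h1 : f 0 = 1 := by
    simp only [f, WithLp.ofLp_zero, Matrix.mulVec_zero, weyl_zero_apply, inner_self_eq_ofReal,
      gaussianFactor_zero, dotProduct_zero]
    simp [hφ]
  obtain ⟨κ, hκ, hc⟩ := exists_charFun_eq hψ hf h1
  refine ⟨ENNReal.ofReal (‖φ‖ ^ 2) • κ.map WithLp.ofLp, ?_, fun p => ?_⟩
  · have := Measure.isProbabilityMeasure_map (μ := κ) hm.aemeasurable
    exact Measure.smul_finite _ ENNReal.ofReal_ne_top
  rw [integral_smul_measure, integral_map hm.aemeasurable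
    (continuous_character p).aestronglyMeasurable, ENNReal.toReal_ofReal (by positivity)]
  have h2 := hc (WithLp.toLp 2 p)
  rw [charFun_apply] at h2
  have h3 : ∀ x : EuclideanSpace ℝ (Fin M), character p x.ofLp =
      Complex.exp ((inner ℝ x (WithLp.toLp 2 p) : ℝ) * Complex.I) := by
    intro x
    rw [EuclideanSpace.inner_eq_star_dotProduct]
    rfl
  simp only [h3]
  rw [h2, Complex.real_smul]
  simp only [f]
  push_cast
  field_simp

theorem exists_isGaussianWith_zero (hA : Aᵀ * Omega N * A = 0) (v : Fin M → ℝ) :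
    ∃ Q : Observable N M, Q.IsGaussianWith A 0 v := by
  choose ν hν hc using exists_measure_weyl hA v
  obtain ⟨Q, hQ⟩ := exists_of_measures ν (fun p => gaussianFactor 0 v p • weyl (A *ᵥ p))
    (by
      ext1 φ
      rw [_root_.smul_apply, Matrix.mulVec_zero, weyl_zero_apply, gaussianFactor_zero,
        dotProduct_zero]
      simp)
    (fun φ p => by rw [hc, _root_.smul_apply, inner_smul_right])
  refine ⟨Q, ?_, fun p φ => ⟨(isBddMeas_character p).integrable _, ?_⟩⟩
  · rw [hA]
    have : ((0 : Matrix (Fin M) (Fin M) ℝ).map Complex.ofReal -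
        Complex.I • (0 : Matrix (Fin M) (Fin M) ℝ).map Complex.ofReal) = 0 := by
      ext i j
      simp
    rw [this]
    exact Matrix.PosSemidef.zero
  · rw [hQ, hc, _root_.smul_apply, inner_smul_right]

/-! ### Sharp and commutative Gaussian observables -/

theorem IsSharp.isCommutative (hE : E.IsSharp) : E.IsCommutative := fun X Y hX hY => by
  rw [hE X Y hX hY, hE Y X hY hX, Set.inter_comm]

/-- Since `S q * S p = S (p + q)`, the complex measures `⟨φ, E(dx) S p φ⟩` and `exp(i pᵀx) ⟨φ, E(dx)
φ⟩` have equal Fourier transforms. Reading this equality on a set `X`, as an identity in `p`, gives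
the transform of `⟨E(X) φ, E(dx) φ⟩`; a second comparison yields `E(X) E(Y) = E(X ∩ Y)`. -/
theorem IsGaussianWith.isSharp_of_zero (hE : E.IsGaussianWith A 0 v) : E.IsSharp := by
  have hA := isotropic_of_posSemidef_zero hE.1
  have h1 (p : Fin M → ℝ) (φ : Hilb N) (X : Set (Fin M → ℝ)) (hX : MeasurableSet X) :
      inner ℂ φ (E.op X ((gaussianFactor 0 v p • weyl (A *ᵥ p)) φ)) =
        ∫ x, character p x * X.indicator (fun _ => 1) x ∂(E.diagMeasure φ) := by
    have h := ((E.isComplexFunctional_offDiag φ ((gaussianFactor 0 v p • weyl (A *ᵥ p)) φ)).sub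
      ((isComplexFunctional_integral (E.diagMeasure φ)).mul
        (isBddMeas_character p))).eq_zero_of_character (fun q => by
          simp only [(hE.2 q).offDiag_eq, ← character_add, hE.integral_character]
          simp only [_root_.smul_apply, map_smul, inner_smul_right, weyl_isotropic hA,
            gaussianFactor_zero_add, add_comm q p]
          ring) (isBddMeas_indicator hX)
    rwa [(E.hasIntegral_indicator hX).offDiag_eq, sub_eq_zero] at h
  intro X Y hX hY
  refine eq_of_inner_map fun φ => ?_
  have h := ((E.isComplexFunctional_offDiag (E.op X φ) φ).sub
    ((isComplexFunctional_integral (E.diagMeasure φ)).mul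
      (isBddMeas_indicator hX))).eq_zero_of_character (fun q => by
        simp only [(hE.2 q).offDiag_eq, op_isSelfAdjoint hX, h1 q φ X hX, mul_comm, sub_self])
      (isBddMeas_indicator hY)
  rw [(E.hasIntegral_indicator hY).offDiag_eq, op_isSelfAdjoint hX, sub_eq_zero] at h
  refine h.trans ?_
  rw [← E.diagMeasure_real φ (hX.inter hY), ← integral_indicator_one_complex _ (hX.inter hY)]
  congr 1
  funext x
  by_cases hx : x ∈ X <;> by_cases hy : x ∈ Y <;> simp [hx, hy]

/-- For a sharp observable integration is multiplicative, so `S (-p) * S p` has expectation one in a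
unit vector; its value from the Weyl relation is `exp(-pᵀBp/2)`. Thus the quadratic form of the
symmetric matrix `B` vanishes. -/
theorem IsGaussianWith.eq_zero_of_isSharp (hE : E.IsGaussianWith A B v) (hs : E.IsSharp) :
    B = 0 := by
  obtain ⟨φ, hφ⟩ := exists_hilb_norm_eq_one N
  have hq (p : Fin M → ℝ) : p ⬝ᵥ (B *ᵥ p) = 0 := by
    set S : Hilb N →L[ℂ] Hilb N := gaussianFactor B v p • weyl (A *ᵥ p) with hS
    have h1 (X : Set (Fin M → ℝ)) (hX : MeasurableSet X) :
        inner ℂ φ (E.op X (S φ)) =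
          ∫ x, X.indicator (fun _ => 1) x * character p x ∂(E.diagMeasure φ) := by
      have h := ((E.isComplexFunctional_offDiag (E.op X φ) φ).sub
        ((isComplexFunctional_integral (E.diagMeasure φ)).mul
          (isBddMeas_indicator hX))).eq_zero_of_indicator (fun Y hY => by
            rw [(E.hasIntegral_indicator hY).offDiag_eq, op_isSelfAdjoint hX, sub_eq_zero]
            have := congrArg (fun R : Hilb N →L[ℂ] Hilb N => inner ℂ φ (R φ)) (hs X Y hX hY)
            refine Eq.trans this ?_
            rw [← E.diagMeasure_real φ (hX.inter hY),
              ← integral_indicator_one_complex _ (hX.inter hY)]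
            congr 1
            funext x
            by_cases hx : x ∈ X <;> by_cases hy : x ∈ Y <;> simp [hx, hy])
          (isBddMeas_character p)
      rwa [(hE.2 p).offDiag_eq, op_isSelfAdjoint hX, sub_eq_zero] at h
    have h2 := ((E.isComplexFunctional_offDiag φ (S φ)).sub
      ((isComplexFunctional_integral (E.diagMeasure φ)).mul
        (isBddMeas_character p))).eq_zero_of_indicator (fun X hX => by
          rw [(E.hasIntegral_indicator hX).offDiag_eq, h1 X hX, sub_eq_zero]
          simp only [mul_comm]) (isBddMeas_character (-p))
    rw [(hE.2 (-p)).offDiag_eq, sub_eq_zero] at h2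
    simp only [← character_add, add_neg_cancel, hE.integral_character, Matrix.mulVec_zero,
      weyl_zero_apply, inner_self_eq_ofReal, hφ, hS, _root_.smul_apply, map_smul,
      inner_smul_right, Matrix.mulVec_neg] at h2
    have h3 : weyl (-(A *ᵥ p)) (weyl (A *ᵥ p) φ) = φ := by
      simpa using weyl_weyl_neg (-(A *ᵥ p)) φ
    have h4 : gaussianFactor B v 0 = 1 := by simp [gaussianFactor]
    rw [h3, h4, inner_self_eq_ofReal, hφ, ← mul_assoc, mul_comm (gaussianFactor B v p),
      gaussianFactor_neg_mul] at h2
    simp only [one_pow, Complex.ofReal_one, mul_one, ← Complex.ofReal_exp] at h2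
    have h5 : Real.exp (-(1 / 2) * (p ⬝ᵥ (B *ᵥ p))) = 1 := by exact_mod_cast h2
    rw [Real.exp_eq_one_iff] at h5
    linarith
  ext i j
  have h := hq (Pi.single i 1 + Pi.single j 1)
  rw [Matrix.mulVec_add, add_dotProduct, dotProduct_add, dotProduct_add, hq, hq] at h
  have hsymm := symm_of_posSemidef hE.1 i j
  simp at h
  simp only [Matrix.zero_apply]
  linarith

theorem IsGaussianWith.isSharp_iff (hE : E.IsGaussianWith A B v) : E.IsSharp ↔ B = 0 :=
  ⟨hE.eq_zero_of_isSharp, fun h => by subst h; exact hE.isSharp_of_zero⟩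

/-- Applying the commutation lemma once in each factor passes from effects to the operators `S p`,
`S q`; the nonzero Gaussian factors cancel and only the Weyl phases remain. -/
theorem IsGaussianWith.isotropic_of_isCommutative (hE : E.IsGaussianWith A B v)
    (hc : E.IsCommutative) : Aᵀ * Omega N * A = 0 := by
  obtain ⟨φ, hφ⟩ := exists_hilb_norm_eq_one N
  have h1 (p : Fin M → ℝ) (X : Set (Fin M → ℝ)) (hX : MeasurableSet X) :=
    (hE.2 p).commute_of_commute_op (isBddMeas_character p) fun Y hY => hc X Y hX hY
  have h2 (p q : Fin M → ℝ) := (hE.2 q).commute_of_commute_op (isBddMeas_character q)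
    fun X hX => (h1 p X hX).symm
  have h3 (p q : Fin M → ℝ) : halfPhase (symp (A *ᵥ p) (A *ᵥ q)) =
      halfPhase (symp (A *ᵥ q) (A *ᵥ p)) := by
    have h4 := congrArg (fun R : Hilb N →L[ℂ] Hilb N => R φ) (h2 p q)
    simp only [mul_apply_eq_comp, _root_.smul_apply, map_smul, weyl_weyl, add_comm (A *ᵥ q)] at h4
    have hne : weyl (A *ᵥ p + A *ᵥ q) φ ≠ 0 := by
      rw [← norm_ne_zero_iff, norm_weyl, hφ]
      exact one_ne_zero
    simp only [smul_smul] at h4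
    have h5 := smul_left_injective ℂ hne h4
    have h6 := gaussianFactor_ne_zero (B := B) v p
    have h7 := gaussianFactor_ne_zero (B := B) v q
    refine mul_left_cancel₀ (mul_ne_zero h6 h7) ?_
    linear_combination h5
  refine isotropic_of_symp fun p q => ?_
  by_contra hs
  -- Equal phases fix the form only modulo `2π`. Rescaling `q` makes its value `π`, where the two
  -- phases are `-i` and `i`.
  have h8 := h3 p ((Real.pi / symp (A *ᵥ p) (A *ᵥ q)) • q)
  rw [symp_comm (A *ᵥ _) (A *ᵥ p), Matrix.mulVec_smul, symp_smul_right,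
    div_mul_cancel₀ _ hs, halfPhase, halfPhase] at h8
  have e1 : Complex.exp (((-(Real.pi / 2) : ℝ) : ℂ) * Complex.I) = -Complex.I := by
    rw [show ((-(Real.pi / 2) : ℝ) : ℂ) * Complex.I = -(Real.pi / 2 * Complex.I) by push_cast; ring,
      Complex.exp_neg, Complex.exp_pi_div_two_mul_I, Complex.inv_I]
  have e2 : Complex.exp (((-(-Real.pi / 2) : ℝ) : ℂ) * Complex.I) = Complex.I := by
    rw [show ((-(-Real.pi / 2) : ℝ) : ℂ) * Complex.I = Real.pi / 2 * Complex.I by push_cast; ring,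
      Complex.exp_pi_div_two_mul_I]
  rw [e1, e2] at h8
  have := congrArg Complex.im h8
  norm_num at this

theorem isBddMeas_translate (μ : Measure (Fin M → ℝ)) [IsProbabilityMeasure μ]
    {X : Set (Fin M → ℝ)} (hX : MeasurableSet X) :
    IsBddMeas fun x => ((μ.real {y | y + x ∈ X} : ℝ) : ℂ) := by
  refine IsBddMeas.ofReal ?_ (C := 1) fun x => ?_
  · have hs : MeasurableSet {z : (Fin M → ℝ) × (Fin M → ℝ) | z.1 + z.2 ∈ X} :=
      (measurable_fst.add measurable_snd) hX
    exact (measurable_measure_prodMk_right (μ := μ) hs).ennreal_toReal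
  · rw [abs_of_nonneg measureReal_nonneg]
    exact measureReal_le_one

theorem IsGaussianSmearingOfSharp.isCommutative (h : E.IsGaussianSmearingOfSharp) :
    E.IsCommutative := by
  obtain ⟨μ, Q, ⟨C, d, hμ⟩, -, hs, hsm⟩ := h
  have := hμ.1
  have h1 (X Y : Set (Fin M → ℝ)) (hX : MeasurableSet X) (hY : MeasurableSet Y) :=
    (hsm X hX).commute_of_commute_op (isBddMeas_translate μ hX)
      fun Z hZ => hs.isCommutative Y Z hY hZ
  intro X Y hX hY
  exact (hsm Y hY).commute_of_commute_op (isBddMeas_translate μ hY)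
    fun Z hZ => (h1 X Z hX hZ).symm

theorem integral_conv_eq {μ ν : Measure (Fin M → ℝ)} [IsFiniteMeasure μ] [IsFiniteMeasure ν]
    {g : (Fin M → ℝ) → ℂ} (hg : IsBddMeas g) :
    ∫ x, g x ∂(μ.conv ν) = ∫ x, ∫ y, g (y + x) ∂μ ∂ν := by
  have hm : Measurable fun z : (Fin M → ℝ) × (Fin M → ℝ) => z.1 + z.2 :=
    measurable_fst.add measurable_snd
  rw [Measure.conv, integral_map hm.aemeasurable hg.1.aestronglyMeasurable, integral_prod_symm]
  exact IsBddMeas.integrable ⟨hg.1.comp hm, hg.2.imp fun C hC z => hC _⟩ _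

/-- In every vector the characteristic function of `E` is that of `Q` times that of `μ`, so the
outcome distribution is a convolution. -/
theorem IsGaussianWith.isSmearing {Q : Observable N M} {μ : Measure (Fin M → ℝ)}
    (hE : E.IsGaussianWith A B v) (hQ : Q.IsGaussianWith A 0 0)
    (hμ : IsGaussianMeasureWith μ B v) : E.IsSmearing μ Q := by
  have := hμ.1
  have hconv (φ : Hilb N) : E.diagMeasure φ = μ.conv (Q.diagMeasure φ) := by
    refine measure_ext_of_character fun p => ?_
    have hadd (x y : Fin M → ℝ) : character p (y + x) = character p y * character p x := by
      rw [character, character, character, ← Complex.exp_add, dotProduct_add]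
      push_cast
      ring_nf
    rw [integral_conv_eq (isBddMeas_character p), hE.integral_character]
    simp only [hadd, integral_mul_const, integral_const_mul, hμ.2.2, hQ.integral_character]
    rw [gaussianFactor_zero, zero_dotProduct]
    simp
  intro X hX φ
  refine ⟨(isBddMeas_translate μ hX).integrable _, ?_⟩
  rw [← E.diagMeasure_real φ hX, ← integral_indicator_one_complex _ hX, hconv,
    integral_conv_eq (isBddMeas_indicator hX)]
  congr 1
  funext x
  beta_reduce
  have hx : MeasurableSet {y | y + x ∈ X} := (measurable_id.add_const x) hX
  rw [← integral_indicator_one_complex _ hx]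
  rfl

theorem IsGaussianWith.exists_smearing (hE : E.IsGaussianWith A B v)
    (hA : Aᵀ * Omega N * A = 0) : ∃ (μ : Measure (Fin M → ℝ)) (Q : Observable N M),
      IsGaussianMeasureWith μ B v ∧ Q.IsGaussianWith A 0 0 ∧ Q.IsSharp ∧ E.IsSmearing μ Q := by
  obtain ⟨μ, hμ⟩ := exists_isGaussianMeasureWith (posSemidef_of_isotropic hE.1 hA) v
  obtain ⟨Q, hQ⟩ := exists_isGaussianWith_zero hA 0
  exact ⟨μ, Q, hμ, hQ, hQ.isSharp_of_zero, hE.isSmearing hQ hμ⟩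

theorem isGaussianSmearingOfSharp_of_exists
    (h : ∃ (μ : Measure (Fin M → ℝ)) (Q : Observable N M), IsGaussianMeasureWith μ B v ∧
      Q.IsGaussianWith A 0 0 ∧ Q.IsSharp ∧ E.IsSmearing μ Q) : E.IsGaussianSmearingOfSharp := by
  obtain ⟨μ, Q, hμ, hQ, hs, hsm⟩ := h
  exact ⟨μ, Q, ⟨B, v, hμ⟩, ⟨A, 0, 0, hQ⟩, hs, hsm⟩

theorem op_union_of_disjoint {X Y : Set (Fin M → ℝ)} (hX : MeasurableSet X)
    (hY : MeasurableSet Y) (hd : Disjoint X Y) : E.op (X ∪ Y) = E.op X + E.op Y := by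
  refine eq_of_inner_map fun φ => ?_
  rw [_root_.add_apply, inner_add_right, ← E.diagMeasure_real φ hX, ← E.diagMeasure_real φ hY,
    ← E.diagMeasure_real φ (hX.union hY), measureReal_union hd hY, Complex.ofReal_add]

/-- For disjoint sets the sum of the projections `P`, `R` is again a projection, so `PR + RP = 0`.
Multiplying by `P` on either side gives `PR = RP`, hence `PR = 0`. Splitting `X` and `Y` along `X ∩
Y` then gives sharpness. -/
theorem IsProjectionValued.isCommutative (hE : E.IsProjectionValued) : E.IsCommutative := by
  have hmul (X Y : Set (Fin M → ℝ)) (hX : MeasurableSet X) (hY : MeasurableSet Y)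
      (hd : Disjoint X Y) : E.op X * E.op Y = 0 := by
    have h1 := (hE X hX).isIdempotentElem.eq
    have h2 := (hE Y hY).isIdempotentElem.eq
    have h3 := (hE _ (hX.union hY)).isIdempotentElem.eq
    rw [op_union_of_disjoint hX hY hd] at h3
    set P := E.op X
    set R := E.op Y
    have h4 : P * R + R * P = 0 := by
      rw [mul_add, add_mul, add_mul, h1, h2] at h3
      have : P * R + R * P = (P + R * P + (P * R + R)) - (P + R) := by abel
      rw [this, h3, sub_self]
    have h5 : P * R * P = P * R * P + (P * R + P * R * P) := by
      have := congrArg (fun S => P * S) h4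
      simp only [mul_add, mul_zero, ← mul_assoc, h1] at this
      rw [this, add_zero]
    have h6 : P * R * P + R * P = 0 := by
      have := congrArg (fun S => S * P) h4
      simpa only [add_mul, zero_mul, mul_assoc, h1] using this
    have h7 : P * R + P * R * P = 0 := by
      simpa using h5.symm
    have h8 : P * R = R * P := by
      rw [eq_neg_of_add_eq_zero_left h7, eq_neg_of_add_eq_zero_right h6]
    rw [← h8, ← two_smul ℂ] at h4
    exact (smul_eq_zero.1 h4).resolve_left two_ne_zero
  have hsharp (X Y : Set (Fin M → ℝ)) (hX : MeasurableSet X) (hY : MeasurableSet Y) :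
      E.op X * E.op Y = E.op (X ∩ Y) := by
    have hXe : E.op X = E.op (X ∩ Y) + E.op (X \ Y) := by
      rw [← op_union_of_disjoint (hX.inter hY) (hX.diff hY) Set.disjoint_sdiff_inter.symm,
        Set.inter_union_sdiff]
    have hYe : E.op Y = E.op (X ∩ Y) + E.op (Y \ X) := by
      rw [Set.inter_comm, ← op_union_of_disjoint (hY.inter hX) (hY.diff hX)
        Set.disjoint_sdiff_inter.symm, Set.inter_union_sdiff]
    rw [hXe, add_mul, hmul _ Y (hX.diff hY) hY Set.disjoint_sdiff_left, add_zero, hYe, mul_add,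
      hmul _ (Y \ X) (hX.inter hY) (hY.diff hX)
        (Set.disjoint_sdiff_right.mono_left Set.inter_subset_left), add_zero]
    exact (hE _ (hX.inter hY)).isIdempotentElem.eq
  exact IsSharp.isCommutative hsharp

end Observable

/-! ### Informational incompleteness -/

section Mixture

variable {N : ℕ} {κ : Type*} [Fintype κ]

/-- The mixture of the pure states of the vectors `φ k` with the weights `r k`. -/
def mixture (r : κ → ℝ) (φ : κ → Hilb N) : Hilb N →L[ℂ] Hilb N :=
  ∑ k, (r k : ℂ) • InnerProductSpace.rankOne ℂ (φ k) (φ k)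

theorem hasSum_rankOne_mul (φ : Hilb N) (T : Hilb N →L[ℂ] Hilb N) :
    HasSum (fun i => inner ℂ (basis N i)
      ((InnerProductSpace.rankOne ℂ φ φ * T) (basis N i))) (inner ℂ φ (T φ)) := by
  have h := (basis N).hasSum_inner_mul_inner (ContinuousLinearMap.adjoint T φ) φ
  rw [ContinuousLinearMap.adjoint_inner_left] at h
  refine h.congr_fun fun i => ?_
  rw [mul_apply_eq_comp, InnerProductSpace.rankOne_apply, inner_smul_right,
    ContinuousLinearMap.adjoint_inner_left]

theorem hasSum_mixture_mul (r : κ → ℝ) (φ : κ → Hilb N) (T : Hilb N →L[ℂ] Hilb N) :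
    HasSum (fun i => inner ℂ (basis N i) ((mixture r φ * T) (basis N i)))
      (∑ k, (r k : ℂ) * inner ℂ (φ k) (T (φ k))) := by
  have h := hasSum_sum (s := Finset.univ) fun k _ =>
    (hasSum_rankOne_mul (φ k) T).mul_left (r k : ℂ)
  refine h.congr_fun fun i => ?_
  simp only [mixture, mul_apply_eq_comp, _root_.sum_apply, _root_.smul_apply, inner_sum,
    inner_smul_right]

theorem trace_mixture_mul (r : κ → ℝ) (φ : κ → Hilb N) (T : Hilb N →L[ℂ] Hilb N) :
    trace (mixture r φ * T) = ∑ k, (r k : ℂ) * inner ℂ (φ k) (T (φ k)) :=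
  (hasSum_mixture_mul r φ T).tsum_eq

theorem isState_mixture {r : κ → ℝ} {φ : κ → Hilb N} (hr : ∀ k, 0 ≤ r k) (h1 : ∑ k, r k = 1)
    (hφ : ∀ k, ‖φ k‖ = 1) : IsState (mixture r φ) := by
  refine ⟨ContinuousLinearMap.isPositive_sum _ fun k _ =>
    (InnerProductSpace.isPositive_rankOne_self _).smul_of_nonneg (by exact_mod_cast hr k), ?_⟩
  have h := hasSum_mixture_mul r φ 1
  simp only [mul_one, one_apply_eq_self, inner_self_eq_ofReal, hφ, one_pow, Complex.ofReal_one]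
    at h
  rw [← Complex.ofReal_sum, h1, Complex.ofReal_one] at h
  exact h

end Mixture

/-! ### Weyl shifts and generic Weyl operators -/

section Shift

variable {N : ℕ}

theorem norm_halfPhase (s : ℝ) : ‖halfPhase s‖ = 1 :=
  Complex.norm_exp_ofReal_mul_I _

theorem inner_smul_map_smul {c : ℂ} (hc : ‖c‖ = 1) (T : Hilb N →L[ℂ] Hilb N) (φ : Hilb N) :
    inner ℂ (c • φ) (T (c • φ)) = inner ℂ φ (T φ) := by
  rw [map_smul, inner_smul_left, inner_smul_right, ← mul_assoc, Complex.conj_mul', hc]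
  simp

/-- The expectation of `T` in a Weyl shifted state is invariant under a further shift that
commutes with `T`. -/
theorem inner_weyl_add_of_commute {w : PhaseSpace N} {T : Hilb N →L[ℂ] Hilb N}
    (hT : weyl w * T = T * weyl w) (z : PhaseSpace N) (φ : Hilb N) :
    inner ℂ (weyl (w + z) φ) (T (weyl (w + z) φ)) = inner ℂ (weyl z φ) (T (weyl z φ)) := by
  rw [← inner_smul_map_smul (norm_halfPhase (symp w z)), ← weyl_weyl]
  have h := congrArg (fun R : Hilb N →L[ℂ] Hilb N => R (weyl z φ)) hT
  simp only [mul_apply_eq_comp] at h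
  rw [← h, inner_weyl_weyl]

theorem inner_weyl_weyl_weyl (x z : PhaseSpace N) (φ : Hilb N) :
    inner ℂ (weyl z φ) (weyl x (weyl z φ)) =
      Complex.exp (((-symp x z : ℝ) : ℂ) * Complex.I) * inner ℂ φ (weyl x φ) := by
  have h : weyl x (weyl z φ) =
      Complex.exp (((-symp x z : ℝ) : ℂ) * Complex.I) • weyl z (weyl x φ) := by
    rw [weyl_weyl, weyl_weyl, smul_smul, add_comm z x, symp_comm z x, halfPhase, halfPhase,
      ← Complex.exp_add, ← add_mul, ← Complex.ofReal_add]
    congr 4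
    ring
  rw [h, inner_smul_right, inner_weyl_weyl]

theorem exists_symp_ne_zero {w : PhaseSpace N} (hw : w ≠ 0) : ∃ x, symp x w ≠ 0 := by
  refine ⟨Omega N *ᵥ w, fun h => hw ?_⟩
  have h1 : Omega N *ᵥ w = 0 := dotProduct_self_eq_zero.1 h
  have h2 : Omega N *ᵥ (Omega N *ᵥ w) = -w := by
    rw [Matrix.mulVec_mulVec, Omega_mul_self, Matrix.neg_mulVec, Matrix.one_mulVec]
  rw [h1, Matrix.mulVec_zero] at h2
  exact neg_eq_zero.1 h2.symm

/-- By nondegeneracy each condition excludes only a hyperplane, and finitely many hyperplanes do not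
cover the space. -/
theorem exists_forall_symp_ne_zero {κ : Type*} [Finite κ] {w : κ → PhaseSpace N}
    (hw : ∀ k, w k ≠ 0) : ∃ x, ∀ k, symp x (w k) ≠ 0 := by
  let f : κ → Module.Dual ℝ (PhaseSpace N) := fun k =>
    { toFun := fun x => symp x (w k)
      map_add' := fun x y => symp_add_left x y (w k)
      map_smul' := fun c x => smul_dotProduct c x _ }
  exact Module.Dual.exists_forall_ne_zero_of_forall_exists f fun k => exists_symp_ne_zero (hw k)

/-- Some Weyl operator has a nonzero expectation in `φ` and commutes with none of the given
nontrivial Weyl operators. -/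
theorem exists_weyl_generic {κ : Type*} [Finite κ] {w : κ → PhaseSpace N} (hw : ∀ k, w k ≠ 0)
    {φ : Hilb N} (hφ : φ ≠ 0) : ∃ x : PhaseSpace N, inner ℂ φ (weyl x φ) ≠ 0 ∧
      ∀ k, Complex.exp (((-symp x (w k) : ℝ) : ℂ) * Complex.I) ≠ 1 := by
  obtain ⟨x, hx⟩ := exists_forall_symp_ne_zero hw
  have hc : Continuous fun t : ℝ => inner ℂ φ (weyl (t • x) φ) :=
    continuous_const.inner ((continuous_weyl φ).comp (by fun_prop))
  have h1 : ∀ᶠ t in nhdsWithin (0 : ℝ) (Set.Ioi 0), inner ℂ φ (weyl (t • x) φ) ≠ 0 := by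
    refine (hc.tendsto 0).eventually_ne ?_ |>.filter_mono nhdsWithin_le_nhds
    rw [zero_smul, weyl_zero_apply]
    exact inner_self_ne_zero.2 hφ
  have h2 : ∀ k, ∀ᶠ t in nhdsWithin (0 : ℝ) (Set.Ioi 0),
      Complex.exp (((-symp (t • x) (w k) : ℝ) : ℂ) * Complex.I) ≠ 1 := by
    intro k
    have hcont : Continuous fun t : ℝ => t * symp x (w k) := by fun_prop
    -- For small positive `t` the phase angle is nonzero and inside `(-2π, 2π)`, so its cosine is
    -- not one.
    have h3 : ∀ᶠ t in nhdsWithin (0 : ℝ) (Set.Ioi 0),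
        t * symp x (w k) ∈ Set.Ioo (-(2 * Real.pi)) (2 * Real.pi) := by
      refine ((hcont.tendsto 0).eventually (Ioo_mem_nhds ?_ ?_)).filter_mono nhdsWithin_le_nhds
      · have := Real.pi_pos
        simp [this]
      · have := Real.pi_pos
        simp [this]
    filter_upwards [h3, self_mem_nhdsWithin] with t ht ht0 he
    have h4 : symp (t • x) (w k) = t * symp x (w k) := smul_dotProduct t x _
    have h5 := congrArg Complex.re he
    rw [Complex.exp_ofReal_mul_I_re, Real.cos_neg, Complex.one_re, h4,
      Real.cos_eq_one_iff_of_lt_of_lt ht.1 ht.2] at h5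
    exact mul_ne_zero (ne_of_gt ht0) (hx k) h5
  obtain ⟨t, ht1, ht2⟩ := (h1.and (Filter.eventually_all.2 h2)).exists
  exact ⟨t • x, ht1, ht2⟩

/-- An isotropic range is orthogonal to itself, so any nonzero vector in it serves; if the range is
zero, any nonzero vector of the phase space does. -/
theorem exists_symp_mulVec_eq_zero (hN : 0 < N) {M : ℕ} {A : Matrix (PhaseIdx N) (Fin M) ℝ}
    (hA : Aᵀ * Omega N * A = 0) : ∃ w ≠ 0, ∀ p, symp w (A *ᵥ p) = 0 := by
  by_cases h : ∃ q, A *ᵥ q ≠ 0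
  · obtain ⟨q, hq⟩ := h
    exact ⟨A *ᵥ q, hq, symp_eq_zero_of_isotropic hA q⟩
  · push Not at h
    refine ⟨fun _ => 1, fun h0 => ?_, fun p => ?_⟩
    · exact one_ne_zero (congrFun h0 (0, ⟨0, hN⟩))
    · rw [h p, symp, Matrix.mulVec_zero, dotProduct_zero]

end Shift

/-! ### Alternating mixtures of shifted states -/

section AlternatingSum

variable {N : ℕ} {κ : Type*} [Fintype κ] [DecidableEq κ]

/-- The vector `φ`, shifted by the sum of the `w k` with `k ∈ S`. -/
def shiftedVector (w : κ → PhaseSpace N) (φ : Hilb N) (S : Finset κ) : Hilb N :=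
  weyl (∑ k ∈ S, w k) φ

/-- Pair each `S` not containing `k` with `insert k S`: the extra shift commutes with `T`, so the
expectations agree while the signs are opposite. -/
theorem alternating_sum_eq_zero {w : κ → PhaseSpace N} (φ : Hilb N) {T : Hilb N →L[ℂ] Hilb N}
    {k : κ} (hT : weyl (w k) * T = T * weyl (w k)) :
    ∑ S : Finset κ, (-1) ^ S.card *
      inner ℂ (shiftedVector w φ S) (T (shiftedVector w φ S)) = 0 := by
  rw [← Finset.powerset_univ, ← Finset.insert_erase (Finset.mem_univ k),
    Finset.sum_powerset_insert (Finset.notMem_erase k _), ← Finset.sum_add_distrib]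
  refine Finset.sum_eq_zero fun S hS => ?_
  have hk : k ∉ S := fun h => Finset.notMem_erase k _ (Finset.mem_powerset.1 hS h)
  rw [shiftedVector, shiftedVector, Finset.sum_insert hk, inner_weyl_add_of_commute hT,
    Finset.card_insert_of_notMem hk, pow_succ]
  ring

/-- A shift by `z` multiplies the expectation of `W(x)` by `exp(-i symp x z)`, which is
multiplicative over subset sums; the alternating sum is the expanded product. -/
theorem alternating_sum_weyl (w : κ → PhaseSpace N) (φ : Hilb N) (x : PhaseSpace N) :
    ∑ S : Finset κ, (-1) ^ S.card *
      inner ℂ (shiftedVector w φ S) (weyl x (shiftedVector w φ S)) =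
      (∏ k, (1 - Complex.exp (((-symp x (w k) : ℝ) : ℂ) * Complex.I))) *
        inner ℂ φ (weyl x φ) := by
  have hsum (S : Finset κ) : Complex.exp (((-symp x (∑ k ∈ S, w k) : ℝ) : ℂ) * Complex.I) =
      ∏ k ∈ S, Complex.exp (((-symp x (w k) : ℝ) : ℂ) * Complex.I) := by
    induction S using Finset.induction_on with
    | empty => simp [symp]
    | insert k S hk ih =>
      rw [Finset.sum_insert hk, Finset.prod_insert hk, ← ih, ← Complex.exp_add, symp_add_right]
      push_cast
      ring_nf
  rw [Finset.prod_sub, Finset.sum_mul, Finset.powerset_univ]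
  refine Finset.sum_congr rfl fun S _ => ?_
  rw [shiftedVector, inner_weyl_weyl_weyl, hsum]
  simp
  ring

theorem not_informationallyComplete_of_shifts {ι : Type*} [Finite ι] {M : ι → ℕ}
    {E : ∀ j, Observable N (M j)} {w : ι → PhaseSpace N} (hw : ∀ j, w j ≠ 0) (hN : 0 < N)
    (hE : ∀ j X, MeasurableSet X → weyl (w j) * (E j).op X = (E j).op X * weyl (w j)) :
    ¬ InformationallyComplete E := by
  classical
  intro hI
  have := Fintype.ofFinite ι
  obtain ⟨φ, hφ⟩ := exists_hilb_norm_eq_one N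
  -- The additional nonzero shift keeps the index set nonempty even for an empty family, so even and
  -- odd subsets are equally numerous.
  let u : Option ι → PhaseSpace N := fun o => o.elim (fun _ => 1) w
  have hu : ∀ o, u o ≠ 0 := by
    rintro (_ | j)
    · exact fun h0 => one_ne_zero (congrFun h0 (0, ⟨0, hN⟩))
    · exact hw j
  -- The weights `c * (1 ± (-1) ^ S.card)` are uniform on the even, respectively odd, subsets.
  set c : ℝ := (2 ^ Fintype.card (Option ι))⁻¹ with hc
  have hc0 : 0 < c := by positivity
  have hsgn (S : Finset (Option ι)) : (-1 : ℝ) ^ S.card = 1 ∨ (-1 : ℝ) ^ S.card = -1 :=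
    neg_one_pow_eq_or ℝ _
  have halt : ∑ S : Finset (Option ι), (-1 : ℝ) ^ S.card = 0 := by
    have h := Finset.sum_powerset_neg_one_pow_card_of_nonempty
      (Finset.univ_nonempty (α := Option ι))
    rw [Finset.powerset_univ] at h
    exact_mod_cast h
  have hone : ∑ _S : Finset (Option ι), c = 1 := by
    rw [Finset.sum_const, Finset.card_univ, Fintype.card_finset, nsmul_eq_mul, hc]
    push_cast
    exact mul_inv_cancel₀ (by positivity)
  have hn (S : Finset (Option ι)) : ‖shiftedVector u φ S‖ = 1 := by
    rw [shiftedVector, norm_weyl, hφ]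
  have hρ : IsState (mixture (fun S : Finset (Option ι) => c * (1 + (-1) ^ S.card))
      (shiftedVector u φ)) := by
    refine isState_mixture (fun S => ?_) ?_ hn
    · rcases hsgn S with h | h <;> rw [h]
      · positivity
      · simp
    · simp only [mul_add, Finset.sum_add_distrib, mul_one, ← Finset.mul_sum, halt, hone]
      simp
  have hσ : IsState (mixture (fun S : Finset (Option ι) => c * (1 - (-1) ^ S.card))
      (shiftedVector u φ)) := by
    refine isState_mixture (fun S => ?_) ?_ hn
    · rcases hsgn S with h | h <;> rw [h]
      · simp
      · norm_num
        positivity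
    · simp only [mul_sub, Finset.sum_sub_distrib, mul_one, ← Finset.mul_sum, halt, hone]
      simp
  have hdiff (T : Hilb N →L[ℂ] Hilb N) :
      trace (mixture (fun S : Finset (Option ι) => c * (1 + (-1) ^ S.card))
        (shiftedVector u φ) * T) -
      trace (mixture (fun S : Finset (Option ι) => c * (1 - (-1) ^ S.card))
        (shiftedVector u φ) * T) = 2 * c * ∑ S : Finset (Option ι), (-1) ^ S.card *
          inner ℂ (shiftedVector u φ S) (T (shiftedVector u φ S)) := by
    rw [trace_mixture_mul, trace_mixture_mul, ← Finset.sum_sub_distrib, Finset.mul_sum]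
    refine Finset.sum_congr rfl fun S _ => ?_
    push_cast
    ring
  have heq := hI _ _ hρ hσ fun j X hX => by
    have hcomm : weyl (u (some j)) * (E j).op X = (E j).op X * weyl (u (some j)) := hE j X hX
    rw [← sub_eq_zero, hdiff, alternating_sum_eq_zero (w := u) φ hcomm, mul_zero]
  obtain ⟨x, hx1, hx2⟩ := exists_weyl_generic hu (φ := φ)
    (norm_ne_zero_iff.1 (by rw [hφ]; exact one_ne_zero))
  have h := hdiff (weyl x)
  rw [heq, sub_self, alternating_sum_weyl] at h
  refine mul_ne_zero (mul_ne_zero two_ne_zero (by exact_mod_cast hc0.ne'))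
    (mul_ne_zero (Finset.prod_ne_zero_iff.2 fun k _ => ?_) hx1) h.symm
  exact sub_ne_zero.2 (hx2 k).symm

end AlternatingSum

theorem not_informationallyComplete_of_isCommutative {N : ℕ} (hN : 0 < N) {ι : Type*} [Finite ι]
    {M : ι → ℕ} {E : ∀ j, Observable N (M j)} (hG : ∀ j, (E j).IsGaussian)
    (hc : ∀ j, (E j).IsCommutative) : ¬ InformationallyComplete E := by
  choose A B v hE using hG
  choose w hw hsymp using fun j =>
    exists_symp_mulVec_eq_zero hN ((hE j).isotropic_of_isCommutative (hc j))
  refine not_informationallyComplete_of_shifts hw hN fun j X hX =>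
    Observable.commute_op_of_commute_character (hE j).2 (fun p => ?_) hX
  ext1 φ
  simp only [mul_apply_eq_comp, _root_.smul_apply, map_smul]
  rw [weyl_weyl, weyl_weyl, symp_comm (A j *ᵥ p), hsymp, neg_zero, add_comm]

end

end GaussianObs

open GaussianObs in
theorem mainTheorem6 (N : ℕ) :
    (∀ (M : ℕ) (E : Observable N M) (A : Matrix (PhaseIdx N) (Fin M) ℝ)
        (B : Matrix (Fin M) (Fin M) ℝ) (v : Fin M → ℝ), E.IsGaussianWith A B v →
      (E.IsCommutative ↔ Aᵀ * Omega N * A = 0) ∧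
      (E.IsCommutative ↔ E.IsGaussianSmearingOfSharp) ∧
      (E.IsCommutative ↔ ∃ (μ : Measure (Fin M → ℝ)) (Q : Observable N M),
        IsGaussianMeasureWith μ B v ∧ Q.IsGaussianWith A 0 0 ∧ Q.IsSharp ∧ E.IsSmearing μ Q) ∧
      (E.IsSharp ↔ B = 0) ∧
      (E.IsCommutative → A.rank ≤ N)) ∧
    (∀ (M : ℕ) (A : Matrix (PhaseIdx N) (Fin M) ℝ) (v : Fin M → ℝ), Aᵀ * Omega N * A = 0 →
      ∃! Q : Observable N M, Q.IsGaussianWith A 0 v) ∧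
    (0 < N → ∀ (ι : Type*) [Finite ι] (M : ι → ℕ) (E : ∀ j, Observable N (M j)),
      (∀ j, (E j).IsGaussian) →
      ((∀ j, (E j).IsCommutative) → ¬ InformationallyComplete E) ∧
      ((∀ j, (E j).IsProjectionValued) → ¬ InformationallyComplete E)) := by
  refine ⟨fun M E A B v hE => ?_, fun M A v hA => ?_, fun hN ι _ M E hG => ?_⟩
  -- The implications form the cycle (a) ⇒ (b) ⇒ (d) ⇒ (c) ⇒ (a).
  · have hab := hE.isotropic_of_isCommutative
    have hbd := hE.exists_smearing
    have hdc := Observable.isGaussianSmearingOfSharp_of_exists (E := E) (A := A) (B := B) (v := v)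
    have hca := Observable.IsGaussianSmearingOfSharp.isCommutative (E := E)
    exact ⟨⟨hab, fun h => hca (hdc (hbd h))⟩, ⟨fun h => hdc (hbd (hab h)), hca⟩,
      ⟨fun h => hbd (hab h), fun h => hca (hdc h)⟩, hE.isSharp_iff,
      fun h => rank_le_of_isotropic (hab h)⟩
  · obtain ⟨Q, hQ⟩ := Observable.exists_isGaussianWith_zero hA v
    exact ⟨Q, hQ, fun F hF => hF.unique hQ⟩
  · exact ⟨not_informationallyComplete_of_isCommutative hN hG, fun h =>
      not_informationallyComplete_of_isCommutative hN hG fun j => (h j).isCommutative⟩
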